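/- Let $\mathbf k$ be an algebraically closed field of characteristic $0$ and let $H$ be a cocommutative Hopf algebra over $\mathbf k$, with coproduct $\Delta(h)=h_{(1)}\otimes h_{(2)}$, counit $\varepsilon$ and antipode $S$; tensor products without subscript are over $\mathbf k$. Let $L$ be a Lie $H$-pseudoalgebra, i.e. a left $H$-module with a $\mathbf k$-bilinear pseudobracket $L\times L\to(H\otimes H)\otimes_H L$, $(a,b)\mapsto[a*b]$ (where $H$ acts on the right of $H\otimes H$ through $\Delta$), which is $H$-bilinear, $[fa*gb]=((f\otimes g)\otimes_H1)[a*b]$, skew-commutative, $[b*a]=-(\sigma\otimes_H\mathrm{id})[a*b]$ with $\sigma(f\otimes g)=g\otimes f$, and satisfies the Jacobi identity $[a*[b*c]]-((\sigma\otimes\mathrm{id})\otimes_H\mathrm{id})[b*[a*c]]=[[a*b]*c]$ in $H^{\otimes3}\otimes_HL$. Here, if $e*c=\sum(h\otimes l)\otimes_Hd$, then $((f\otimes g)\otimes_He)*c=\sum(fh_{(1)}\otimes gh_{(2)}\otimes l)\otimes_Hd$, and if $a*d=\sum(h\otimes l)\otimes_He$, then $a*((f\otimes g)\otimes_Hd)=\sum(h\otimes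 fl_{(1)}\otimes gl_{(2)})\otimes_He$. For a left $H$-module $M$ every element of $(H\otimes H)\otimes_HM$ can be written as $\sum_i(h_i\otimes1)\otimes_Hm_i$, and $\sum_ih_i\otimes m_i\in H\otimes M$ is then uniquely determined (it is the Fourier transform of the element, $(f\otimes g)\otimes_Hm\mapsto fS(g_{(1)})\otimes g_{(2)}m$). Write $[a,b]=\sum_ih_i\otimes c_i\in H\otimes L$ if $[a*b]=\sum_i(h_i\otimes1)\otimes_Hc_i$. Let $H$ act diagonally on tensor products, and let $L$ act on a tensor product $M\otimes N$ of two $H$-modules with an action of $L$ (such as $L\otimes L$ and $L\otimes L\otimes L$) by $$a*(m\otimes n)=\sum(h\otimes1)\otimes_H(m'\otimes n)+\sum(l\otimes1)\otimes_H(m\otimes n')$$ if $a*m=\sum(h\otimes1)\otimes_Hm'$ and $a*n=\sum(l\otimes1)\otimes_Hn'$. Write $a\cdot x\in H\otimes L^{\otimes3}$ for the Fourier transform of $a*x$, $x\in L^{\otimes3}$. A Lie $H$-coalgebra structure on $L$ is an $H$-linear map $\delta:L\to L\otimes L$ with skew-symmetric values (i.e. $\delta: L\to\wedge^2L$) such that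 $(1\otimes\delta)\delta-\tau_{12}(1\otimes\delta)\delta=(\delta\otimes1)\delta$, where $\tau_{12}$ exchanges the first two factors of $L^{\otimes 3}$. Such a $\delta$ is the cobracket of a Lie pseudo-bialgebra structure on $L$ if moreover $a*\delta(b)-(\sigma\otimes_H1)(b*\delta(a))=\delta([a*b])$ for all $a,b\in L$, where $\delta((f\otimes g)\otimes_He)=(f\otimes g)\otimes_H\delta(e)$. For $r\in L\otimes L$ let $\delta_r=d(1\otimes_Hr):L\to L\otimes L$, where $d$ is the degree-$0$ differential of the reduced cohomology complex: $(d(1\otimes_Hm))(a)=\sum_i\,(\mathrm{id}\otimes\varepsilon)(f_i)\,m_i$ if $a*m=\sum_if_i\otimes_Hm_i$ with $f_i\in H\otimes H$. **Theorem.** Let $r=\sum_ia_i\otimes b_i\in L\otimes L$ (a finite sum) and $r_{21}=\sum_ib_i\otimes a_i$. Then for all $a\in L$ $$\delta_r(a)=\sum_i\mu\big([a,a_i]\otimes b_i+\sigma_{12}(a_i\otimes[a,b_i])\big),$$ where $\mu(h\otimes m\otimes n)=\Delta(h)(m\otimes n)$ and $\sigma_{12}$ moves the $H$-factor to the first place.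 Moreover, $\delta_r$ is the cobracket of a Lie pseudo-bialgebra structure on $L$ if and only if the following two conditions hold: (1) the symmetric part of $r$ is $L$-invariant, i.e. $\delta_{r+r_{21}}(a)=0$ for all $a\in L$; (2) $\mu_3(a\cdot[[r,r]])=0$ for all $a\in L$, where $\mu_3(h\otimes m\otimes n\otimes p)=h_{(1)}m\otimes h_{(2)}n\otimes h_{(3)}p$ and $$[[r,r]]=\sum_{i,j}\Big(\mu_{-1}^3([a_j,a_i]\otimes b_j\otimes b_i)-\mu_{-2}^4(a_i\otimes[a_j,b_i]\otimes b_j)-\mu_{-3}^2(a_i\otimes a_j\otimes[b_j,b_i])\Big)\in L^{\otimes 3}.$$ Here $\mu_{-k}^l$ lets the element of $H$ in the $k$-th place act, through the antipode, on the element of $L$ in the $l$-th place, and removes the $k$-th place; so for $[x,y]=\sum h\otimes c$ the three terms are $\sum c\otimes S(h)b_j\otimes b_i$, $\sum a_i\otimes c\otimes S(h)b_j$ and $\sum a_i\otimes S(h)a_j\otimes c$ (with $[x,y]$ the bracket occurring in the respective term). -/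

import Mathlib

open scoped TensorProduct

noncomputable section

namespace LiePseudo

section Balanced

variable {k H T T' M N X : Type*} [CommRing k] [Ring H] [Algebra k H] [Ring T] [Algebra k T]
  [Ring T'] [Algebra k T'] [AddCommGroup M] [Module k M] [AddCommGroup N] [Module k N]
  [AddCommGroup X] [Module k X]

/-- The relations `t φ(h) ⊗ m = t ⊗ h m` defining the balanced tensor product `T ⊗_H M`, where the
left `H`-module structure of `M` is given by `ρ`, and `H` acts on the right of `T` through `φ`. -/
def balRel (φ : H →ₐ[k] T) (ρ : H →ₐ[k] Module.End k M) : Submodule T (T ⊗[k] M) :=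
  Submodule.span T {x | ∃ (h : H) (m : M), x = φ h ⊗ₜ[k] m - 1 ⊗ₜ[k] ρ h m}

/-- The balanced tensor product `T ⊗_H M`, with its left `T`-module structure. -/
abbrev Bal (φ : H →ₐ[k] T) (ρ : H →ₐ[k] Module.End k M) : Type _ :=
  (T ⊗[k] M) ⧸ balRel φ ρ

/-- The projection `T ⊗ M → T ⊗_H M`. -/
def Bal.proj (φ : H →ₐ[k] T) (ρ : H →ₐ[k] Module.End k M) : T ⊗[k] M →ₗ[T] Bal φ ρ :=
  (balRel φ ρ).mkQ

/-- The class `t ⊗_H m`. -/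
def Bal.tmul (φ : H →ₐ[k] T) (ρ : H →ₐ[k] Module.End k M) (t : T) (m : M) : Bal φ ρ :=
  Bal.proj φ ρ (t ⊗ₜ[k] m)

theorem Bal.tmul_balanced (φ : H →ₐ[k] T) (ρ : H →ₐ[k] Module.End k M) (t : T) (h : H) (m : M) :
    Bal.tmul φ ρ (t * φ h) m = Bal.tmul φ ρ t (ρ h m) := by
  have h1 : Bal.proj φ ρ (φ h ⊗ₜ[k] m - 1 ⊗ₜ[k] ρ h m) = 0 := by
    simp only [Bal.proj, Submodule.mkQ_apply, Submodule.Quotient.mk_eq_zero]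
    exact Submodule.subset_span ⟨h, m, rfl⟩
  have h2 : Bal.proj φ ρ (t • (φ h ⊗ₜ[k] m - 1 ⊗ₜ[k] ρ h m)) = 0 := by
    rw [map_smul, h1, smul_zero]
  rw [smul_sub, TensorProduct.smul_tmul', TensorProduct.smul_tmul', smul_eq_mul, smul_eq_mul,
    mul_one, map_sub, sub_eq_zero] at h2
  exact h2

theorem Bal.smul_tmul (φ : H →ₐ[k] T) (ρ : H →ₐ[k] Module.End k M) (s t : T) (m : M) :
    s • Bal.tmul φ ρ t m = Bal.tmul φ ρ (s * t) m := by
  rw [Bal.tmul, ← map_smul, TensorProduct.smul_tmul', smul_eq_mul]; rfl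

theorem Bal.mul_smul {φ : H →ₐ[k] T} {ρ : H →ₐ[k] Module.End k M} (s t : T) (x : Bal φ ρ) :
    (s * t) • x = s • t • x := SemigroupAction.mul_smul s t x

/-- A balanced linear map descends to `T ⊗_H M`. -/
def Bal.lift (φ : H →ₐ[k] T) (ρ : H →ₐ[k] Module.End k M) (g : T ⊗[k] M →ₗ[k] X)
    (hg : ∀ t h m, g ((t * φ h) ⊗ₜ m) = g (t ⊗ₜ ρ h m)) : Bal φ ρ →ₗ[k] X :=
  ((balRel φ ρ).restrictScalars k).liftQ g (by
    have key : ∀ x ∈ balRel φ ρ, ∀ t : T, g (t • x) = 0 := by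
      intro x hx
      induction hx using Submodule.span_induction with
      | mem x hx =>
        obtain ⟨h, m, rfl⟩ := hx
        intro t
        rw [smul_sub, TensorProduct.smul_tmul', TensorProduct.smul_tmul', smul_eq_mul, smul_eq_mul,
          mul_one, map_sub, hg, sub_self]
      | zero => simp
      | add x y _ _ h1 h2 => intro t; rw [smul_add, map_add, h1, h2, add_zero]
      | smul s x _ h1 => intro t; rw [smul_smul]; exact h1 _
    intro x hx
    rw [LinearMap.mem_ker]
    simpa using key x hx 1) ∘ₗ
  (Submodule.Quotient.restrictScalarsEquiv k (balRel φ ρ)).symm.toLinearMap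

theorem Bal.lift_tmul (φ : H →ₐ[k] T) (ρ : H →ₐ[k] Module.End k M) (g : T ⊗[k] M →ₗ[k] X)
    (hg : ∀ t h m, g ((t * φ h) ⊗ₜ m) = g (t ⊗ₜ ρ h m)) (t : T) (m : M) :
    Bal.lift φ ρ g hg (Bal.tmul φ ρ t m) = g (t ⊗ₜ m) := rfl

theorem Bal.induction_on {φ : H →ₐ[k] T} {ρ : H →ₐ[k] Module.End k M} {p : Bal φ ρ → Prop}
    (x : Bal φ ρ) (tmul : ∀ t m, p (Bal.tmul φ ρ t m)) (add : ∀ x y, p x → p y → p (x + y)) :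
    p x := by
  obtain ⟨y, rfl⟩ := Submodule.mkQ_surjective _ x
  induction y using TensorProduct.induction_on with
  | zero => simpa [Bal.tmul] using tmul 0 0
  | tmul t m => exact tmul t m
  | add x y h1 h2 => rw [map_add]; exact add _ _ h1 h2

theorem Bal.tmul_add (φ : H →ₐ[k] T) (ρ : H →ₐ[k] Module.End k M) (t : T) (m n : M) :
    Bal.tmul φ ρ t (m + n) = Bal.tmul φ ρ t m + Bal.tmul φ ρ t n := by
  rw [Bal.tmul, TensorProduct.tmul_add, map_add]; rfl

theorem Bal.add_tmul (φ : H →ₐ[k] T) (ρ : H →ₐ[k] Module.End k M) (s t : T) (m : M) :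
    Bal.tmul φ ρ (s + t) m = Bal.tmul φ ρ s m + Bal.tmul φ ρ t m := by
  rw [Bal.tmul, TensorProduct.add_tmul, map_add]; rfl

/-- The map `T ⊗_H M → T' ⊗_H M`, `t ⊗_H m ↦ α(t) ⊗_H m`, induced by an algebra homomorphism
`α : T → T'` compatible with the two right actions of `H`. -/
def Bal.map {φ : H →ₐ[k] T} {φ' : H →ₐ[k] T'} (ρ : H →ₐ[k] Module.End k M) (α : T →ₐ[k] T')
    (hα : ∀ h, α (φ h) = φ' h) : Bal φ ρ →ₗ[k] Bal φ' ρ :=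
  Bal.lift φ ρ ((Bal.proj φ' ρ).restrictScalars k ∘ₗ TensorProduct.map α.toLinearMap LinearMap.id)
    (fun t h m => by
      have := Bal.tmul_balanced φ' ρ (α t) h m
      rw [← hα, ← map_mul] at this
      exact this)

theorem Bal.map_tmul {φ : H →ₐ[k] T} {φ' : H →ₐ[k] T'} (ρ : H →ₐ[k] Module.End k M)
    (α : T →ₐ[k] T') (hα : ∀ h, α (φ h) = φ' h) (t : T) (m : M) :
    Bal.map ρ α hα (Bal.tmul φ ρ t m) = Bal.tmul φ' ρ (α t) m := rfl

theorem Bal.map_smul {φ : H →ₐ[k] T} {φ' : H →ₐ[k] T'} (ρ : H →ₐ[k] Module.End k M)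
    (α : T →ₐ[k] T') (hα : ∀ h, α (φ h) = φ' h) (t : T) (x : Bal φ ρ) :
    Bal.map ρ α hα (t • x) = α t • Bal.map ρ α hα x := by
  induction x using Bal.induction_on with
  | tmul s m => rw [Bal.smul_tmul, Bal.map_tmul, Bal.map_tmul, Bal.smul_tmul, map_mul]
  | add x y h1 h2 => rw [smul_add, map_add, h1, h2, map_add, smul_add]

/-- The map `id ⊗_H f : T ⊗_H M → T ⊗_H N` induced by an `H`-linear map `f : M → N`. -/
def Bal.mapRight (φ : H →ₐ[k] T) {ρ : H →ₐ[k] Module.End k M} {ρ' : H →ₐ[k] Module.End k N}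
    (f : M →ₗ[k] N) (hf : ∀ h m, f (ρ h m) = ρ' h (f m)) : Bal φ ρ →ₗ[k] Bal φ ρ' :=
  Bal.lift φ ρ ((Bal.proj φ ρ').restrictScalars k ∘ₗ TensorProduct.map LinearMap.id f)
    (fun t h m => by
      have := Bal.tmul_balanced φ ρ' t h (f m)
      rw [← hf] at this
      exact this)

theorem Bal.mapRight_tmul (φ : H →ₐ[k] T) {ρ : H →ₐ[k] Module.End k M}
    {ρ' : H →ₐ[k] Module.End k N} (f : M →ₗ[k] N) (hf : ∀ h m, f (ρ h m) = ρ' h (f m))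
    (t : T) (m : M) :
    Bal.mapRight φ f hf (Bal.tmul φ ρ t m) = Bal.tmul φ ρ' t (f m) := rfl

theorem Bal.mapRight_smul (φ : H →ₐ[k] T) {ρ : H →ₐ[k] Module.End k M}
    {ρ' : H →ₐ[k] Module.End k N} (f : M →ₗ[k] N) (hf : ∀ h m, f (ρ h m) = ρ' h (f m))
    (t : T) (x : Bal φ ρ) :
    Bal.mapRight φ f hf (t • x) = t • Bal.mapRight φ f hf x := by
  induction x using Bal.induction_on with
  | tmul s m => rw [Bal.smul_tmul, Bal.mapRight_tmul, Bal.mapRight_tmul, Bal.smul_tmul]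
  | add x y h1 h2 => rw [smul_add, map_add, h1, h2, map_add, smul_add]

end Balanced

section Hopf

variable {k H L M N : Type*} [CommRing k] [Ring H] [HopfAlgebra k H]
  [AddCommGroup L] [Module k L] [AddCommGroup M] [Module k M] [AddCommGroup N] [Module k N]

/-- The left `H`-module structure of `L`, as an algebra homomorphism `H → End_k(L)`. -/
abbrev regAct (k H L : Type*) [CommRing k] [Ring H] [HopfAlgebra k H] [AddCommGroup L] [Module k L]
    [Module H L] [IsScalarTower k H L] : H →ₐ[k] Module.End k L :=
  Algebra.lsmul k k L

/-- The diagonal `H`-module structure of `M ⊗ N`: `h (m ⊗ n) = h₍₁₎ m ⊗ h₍₂₎ n`. -/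
def diag (ρ : H →ₐ[k] Module.End k M) (ρ' : H →ₐ[k] Module.End k N) :
    H →ₐ[k] Module.End k (M ⊗[k] N) :=
  (Module.endTensorEndAlgHom.comp (Algebra.TensorProduct.map ρ ρ')).comp
    (Bialgebra.comulAlgHom k H)

/-- The action map `h ⊗ m ↦ h m`. -/
def actMap (ρ : H →ₐ[k] Module.End k M) : H ⊗[k] M →ₗ[k] M :=
  TensorProduct.lift ρ.toLinearMap

/-- The iterated coproduct `(id ⊗ Δ) Δ`. -/
def comul3 (k H : Type*) [CommRing k] [Ring H] [HopfAlgebra k H] :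
    H →ₐ[k] H ⊗[k] (H ⊗[k] H) :=
  (Algebra.TensorProduct.map (AlgHom.id k H) (Bialgebra.comulAlgHom k H)).comp
    (Bialgebra.comulAlgHom k H)

/-- `(H ⊗ H) ⊗_H M`. -/
abbrev PT2 (ρ : H →ₐ[k] Module.End k M) : Type _ := Bal (Bialgebra.comulAlgHom k H) ρ

/-- `(H ⊗ H ⊗ H) ⊗_H M`. -/
abbrev PT3 (ρ : H →ₐ[k] Module.End k M) : Type _ := Bal (comul3 k H) ρ

/-- `k ⊗_H M`, that is `M / H₊ M`. -/
abbrev Coinv (ρ : H →ₐ[k] Module.End k M) : Type _ := Bal (Bialgebra.counitAlgHom k H) ρ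

/-- The Fourier transform `f ⊗ g ↦ f S(g₍₁₎) ⊗ g₍₂₎` of `H ⊗ H`. -/
def fourierH (k H : Type*) [CommRing k] [Ring H] [HopfAlgebra k H] :
    H ⊗[k] H →ₗ[k] H ⊗[k] H :=
  TensorProduct.map (LinearMap.mul' k H) LinearMap.id ∘ₗ
    (TensorProduct.assoc k H H H).symm.toLinearMap ∘ₗ
    TensorProduct.map LinearMap.id
      (TensorProduct.map (HopfAlgebra.antipode k) LinearMap.id ∘ₗ Coalgebra.comul)

/-- The inverse Fourier transform `f ⊗ g ↦ f g₍₁₎ ⊗ g₍₂₎`. -/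
def fourierInvH (k H : Type*) [CommRing k] [Ring H] [HopfAlgebra k H] :
    H ⊗[k] H →ₗ[k] H ⊗[k] H :=
  TensorProduct.map (LinearMap.mul' k H) LinearMap.id ∘ₗ
    (TensorProduct.assoc k H H H).symm.toLinearMap ∘ₗ
    TensorProduct.map LinearMap.id Coalgebra.comul

theorem fourierInvH_tmul (f g : H) :
    fourierInvH k H (f ⊗ₜ g) = (f ⊗ₜ[k] (1 : H)) * Coalgebra.comul g := by
  simp only [fourierInvH, LinearMap.comp_apply, TensorProduct.map_tmul, LinearMap.id_apply]
  generalize (Coalgebra.comul (R := k) g) = z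
  induction z using TensorProduct.induction_on with
  | zero => simp
  | tmul x y => simp
  | add x y h1 h2 => simp only [TensorProduct.tmul_add, map_add, mul_add, h1, h2]

theorem fourierH_tmul (f g : H) :
    fourierH k H (f ⊗ₜ g) = (f ⊗ₜ[k] (1 : H)) *
      TensorProduct.map (HopfAlgebra.antipode k) LinearMap.id (Coalgebra.comul (R := k) g) := by
  simp only [fourierH, LinearMap.comp_apply, TensorProduct.map_tmul, LinearMap.id_apply]
  generalize TensorProduct.map (HopfAlgebra.antipode k) LinearMap.id
    (Coalgebra.comul (R := k) g) = z
  induction z using TensorProduct.induction_on with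
  | zero => simp
  | tmul x y => simp
  | add x y h1 h2 => simp only [TensorProduct.tmul_add, map_add, mul_add, h1, h2]

theorem fourierH_smul (f : H) (t : H ⊗[k] H) :
    fourierH k H ((f ⊗ₜ[k] (1 : H)) * t) = (f ⊗ₜ[k] (1 : H)) * fourierH k H t := by
  induction t using TensorProduct.induction_on with
  | zero => simp
  | tmul x y => simp [fourierH_tmul, ← mul_assoc]
  | add x y h1 h2 => simp only [mul_add, map_add, h1, h2]

theorem fourierInvH_smul (f : H) (t : H ⊗[k] H) :
    fourierInvH k H ((f ⊗ₜ[k] (1 : H)) * t) = (f ⊗ₜ[k] (1 : H)) * fourierInvH k H t := by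
  induction t using TensorProduct.induction_on with
  | zero => simp
  | tmul x y => simp [fourierInvH_tmul, ← mul_assoc]
  | add x y h1 h2 => simp only [mul_add, map_add, h1, h2]

theorem fourierInvH_mul (t : H ⊗[k] H) (h : H) :
    fourierInvH k H (t * ((1 : H) ⊗ₜ[k] h)) = fourierInvH k H t * Coalgebra.comul h := by
  induction t using TensorProduct.induction_on with
  | zero => simp
  | tmul x y => simp [fourierInvH_tmul, mul_assoc]
  | add x y h1 h2 => simp only [add_mul, map_add, h1, h2]

theorem conv_aux (u v : H →ₗ[k] H)
    (huv : ∀ g : H, LinearMap.mul' k H (TensorProduct.map u v (Coalgebra.comul g)) =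
      algebraMap k H (Coalgebra.counit g)) (g : H) :
    (TensorProduct.map (LinearMap.mul' k H) LinearMap.id ∘ₗ
      (TensorProduct.assoc k H H H).symm.toLinearMap ∘ₗ
      TensorProduct.map u (TensorProduct.map v LinearMap.id ∘ₗ Coalgebra.comul))
      (Coalgebra.comul g) = (1 : H) ⊗ₜ[k] g := by
  have h1 : ∀ z : H ⊗[k] (H ⊗[k] H),
      (TensorProduct.map (LinearMap.mul' k H) LinearMap.id ∘ₗ
        (TensorProduct.assoc k H H H).symm.toLinearMap ∘ₗ
        TensorProduct.map u (TensorProduct.map v LinearMap.id)) z =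
      (TensorProduct.map (LinearMap.mul' k H ∘ₗ TensorProduct.map u v) LinearMap.id)
        ((TensorProduct.assoc k H H H).symm z) := by
    intro z
    have : (TensorProduct.map (LinearMap.mul' k H) LinearMap.id ∘ₗ
        (TensorProduct.assoc k H H H).symm.toLinearMap ∘ₗ
        TensorProduct.map u (TensorProduct.map v LinearMap.id)) =
      (TensorProduct.map (LinearMap.mul' k H ∘ₗ TensorProduct.map u v) LinearMap.id) ∘ₗ
        (TensorProduct.assoc k H H H).symm.toLinearMap := by
      ext; simp
    exact LinearMap.congr_fun this z
  have h2 : (TensorProduct.map u (TensorProduct.map v LinearMap.id ∘ₗ Coalgebra.comul))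
      (Coalgebra.comul (R := k) g) =
      (TensorProduct.map u (TensorProduct.map v LinearMap.id))
        (Coalgebra.comul.lTensor H (Coalgebra.comul (R := k) g)) := by
    rw [LinearMap.lTensor, TensorProduct.map_map, LinearMap.comp_id]
  rw [LinearMap.comp_apply, LinearMap.comp_apply, h2, ← LinearMap.comp_apply,
    ← LinearMap.comp_apply, LinearMap.comp_assoc, h1, Coalgebra.coassoc_symm_apply, LinearMap.rTensor,
    ← LinearMap.comp_apply, ← TensorProduct.map_comp, LinearMap.comp_id]
  have h3 : (LinearMap.mul' k H ∘ₗ TensorProduct.map u v) ∘ₗ Coalgebra.comul =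
      Algebra.linearMap k H ∘ₗ Coalgebra.counit := by
    ext g; exact huv g
  rw [h3]
  have := congrArg (TensorProduct.map (Algebra.linearMap k H) LinearMap.id)
    (Coalgebra.rTensor_counit_comul (R := k) g)
  rw [LinearMap.rTensor, ← LinearMap.comp_apply, ← TensorProduct.map_comp] at this
  simpa using this

theorem fourierInvH_fourierH (t : H ⊗[k] H) : fourierInvH k H (fourierH k H t) = t := by
  induction t using TensorProduct.induction_on with
  | zero => simp
  | tmul f g =>
    rw [fourierH_tmul, fourierInvH_smul]
    have := conv_aux (k := k) (HopfAlgebra.antipode k) (LinearMap.id (M := H))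
      (fun g => HopfAlgebra.mul_antipode_rTensor_comul_apply g) g
    have h2 : fourierInvH k H (TensorProduct.map (HopfAlgebra.antipode k) LinearMap.id
        (Coalgebra.comul (R := k) g)) = (1 : H) ⊗ₜ[k] g := by
      rw [← this]
      simp only [fourierInvH, LinearMap.comp_apply, TensorProduct.map_map, LinearMap.comp_id,
        LinearMap.id_comp, TensorProduct.map_id]
    rw [h2]; simp
  | add x y h1 h2 => simp only [map_add, h1, h2]

theorem fourierH_fourierInvH (t : H ⊗[k] H) : fourierH k H (fourierInvH k H t) = t := by
  induction t using TensorProduct.induction_on with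
  | zero => simp
  | tmul f g =>
    rw [fourierInvH_tmul, fourierH_smul]
    have := conv_aux (k := k) (LinearMap.id (M := H)) (HopfAlgebra.antipode k)
      (fun g => HopfAlgebra.mul_antipode_lTensor_comul_apply g) g
    have h2 : fourierH k H (Coalgebra.comul (R := k) g) = (1 : H) ⊗ₜ[k] g := this
    rw [h2]; simp
  | add x y h1 h2 => simp only [map_add, h1, h2]

theorem fourierH_mul_comul (t : H ⊗[k] H) (h : H) :
    fourierH k H (t * Coalgebra.comul h) = fourierH k H t * ((1 : H) ⊗ₜ[k] h) := by
  conv_lhs => rw [← fourierInvH_fourierH t, ← fourierInvH_mul, fourierH_fourierInvH]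

/-- The map `(f ⊗ g) ⊗ m ↦ f ⊗ g m`. -/
def actSnd (ρ : H →ₐ[k] Module.End k M) : (H ⊗[k] H) ⊗[k] M →ₗ[k] H ⊗[k] M :=
  TensorProduct.map LinearMap.id (actMap ρ) ∘ₗ (TensorProduct.assoc k H H M).toLinearMap

theorem actSnd_mul (ρ : H →ₐ[k] Module.End k M) (t : H ⊗[k] H) (h : H) (m : M) :
    actSnd ρ ((t * ((1 : H) ⊗ₜ[k] h)) ⊗ₜ m) = actSnd ρ (t ⊗ₜ ρ h m) := by
  induction t using TensorProduct.induction_on with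
  | zero => simp
  | tmul x y => simp [actSnd, actMap]
  | add x y h1 h2 => simp only [add_mul, TensorProduct.add_tmul, map_add, h1, h2]

/-- The Fourier transform `(H ⊗ H) ⊗_H M → H ⊗ M`,
`(f ⊗ g) ⊗_H m ↦ f S(g₍₁₎) ⊗ g₍₂₎ m`; it sends `(h ⊗ 1) ⊗_H m` to `h ⊗ m`. -/
def fourier (ρ : H →ₐ[k] Module.End k M) : PT2 ρ →ₗ[k] H ⊗[k] M :=
  Bal.lift _ ρ (actSnd ρ ∘ₗ TensorProduct.map (fourierH k H) LinearMap.id) (fun t h m => by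
    simp only [LinearMap.comp_apply, TensorProduct.map_tmul, LinearMap.id_apply]
    rw [Bialgebra.comulAlgHom_apply, fourierH_mul_comul, actSnd_mul])

/-- The map `H ⊗ M → (H ⊗ H) ⊗_H M`, `h ⊗ m ↦ (h ⊗ 1) ⊗_H m`. -/
def unFourier (ρ : H →ₐ[k] Module.End k M) : H ⊗[k] M →ₗ[k] PT2 ρ :=
  (Bal.proj _ ρ).restrictScalars k ∘ₗ
    TensorProduct.map ((TensorProduct.mk k H H).flip 1) LinearMap.id

theorem unFourier_tmul (ρ : H →ₐ[k] Module.End k M) (h : H) (m : M) :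
    unFourier ρ (h ⊗ₜ m) = Bal.tmul _ ρ (h ⊗ₜ 1) m := rfl

theorem fourier_tmul (ρ : H →ₐ[k] Module.End k M) (t : H ⊗[k] H) (m : M) :
    fourier ρ (Bal.tmul _ ρ t m) = actSnd ρ (fourierH k H t ⊗ₜ m) := rfl

theorem unFourier_actSnd (ρ : H →ₐ[k] Module.End k M) (t : H ⊗[k] H) (m : M) :
    unFourier ρ (actSnd ρ (t ⊗ₜ m)) = Bal.tmul _ ρ (fourierInvH k H t) m := by
  induction t using TensorProduct.induction_on with
  | zero => simp [Bal.tmul]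
  | tmul f g =>
    rw [fourierInvH_tmul, ← Bialgebra.comulAlgHom_apply, Bal.tmul_balanced]
    rfl
  | add x y h1 h2 => rw [TensorProduct.add_tmul, map_add, map_add, h1, h2, map_add, Bal.add_tmul]

theorem unFourier_fourier (ρ : H →ₐ[k] Module.End k M) (x : PT2 ρ) :
    unFourier ρ (fourier ρ x) = x := by
  induction x using Bal.induction_on with
  | tmul t m => rw [fourier_tmul, unFourier_actSnd, fourierInvH_fourierH]
  | add x y h1 h2 => simp only [map_add, h1, h2]

theorem fourier_unFourier (ρ : H →ₐ[k] Module.End k M) (x : H ⊗[k] M) :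
    fourier ρ (unFourier ρ x) = x := by
  induction x using TensorProduct.induction_on with
  | zero => simp
  | tmul h m =>
    rw [unFourier_tmul, fourier_tmul]
    simp [fourierH_tmul, actSnd, actMap, Algebra.TensorProduct.one_def]
  | add x y h1 h2 => simp only [map_add, h1, h2]

/-- The map `(f ⊗ g) ⊗_H m ↦ (id ⊗ ε)(f ⊗ g) m`. -/
def evalCounit (ρ : H →ₐ[k] Module.End k M) : PT2 ρ →ₗ[k] M :=
  Bal.lift _ ρ (actMap ρ ∘ₗ TensorProduct.map
      ((TensorProduct.rid k H).toLinearMap ∘ₗ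
        TensorProduct.map LinearMap.id Coalgebra.counit) LinearMap.id) (fun t h m => by
    have h1 : ∀ s t : H ⊗[k] H, (TensorProduct.rid k H)
        (TensorProduct.map LinearMap.id Coalgebra.counit (s * t)) =
        (TensorProduct.rid k H) (TensorProduct.map LinearMap.id Coalgebra.counit s) *
        (TensorProduct.rid k H) (TensorProduct.map LinearMap.id Coalgebra.counit t) :=
      fun s t => map_mul ((Algebra.TensorProduct.rid k k H).toAlgHom.comp
        (Algebra.TensorProduct.map (AlgHom.id k H) (Bialgebra.counitAlgHom k H))) s t
    have h2 := congrArg (TensorProduct.rid k H) (Coalgebra.lTensor_counit_comul (R := k) h)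
    simp only [LinearMap.lTensor, TensorProduct.rid_tmul, one_smul] at h2
    simp [actMap, h1, h2])

theorem evalCounit_tmul (ρ : H →ₐ[k] Module.End k M) (t : H ⊗[k] H) (m : M) :
    evalCounit ρ (Bal.tmul _ ρ t m) = actMap ρ (((TensorProduct.rid k H)
      (TensorProduct.map LinearMap.id Coalgebra.counit t)) ⊗ₜ m) := rfl

/-- An `H`-bilinear map `L ⊗ M → (H ⊗ H) ⊗_H M`, `a ⊗ m ↦ a * m`, that is
`fa * gm = ((f ⊗ g) ⊗_H 1) (a * m)`. For `M = L` this is a pseudoproduct on `L`. -/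
structure PseudoAction (ρL : H →ₐ[k] Module.End k L) (ρM : H →ₐ[k] Module.End k M) where
  act : L →ₗ[k] M →ₗ[k] PT2 ρM
  act_smul : ∀ (f g : H) (a : L) (m : M), act (ρL f a) (ρM g m) = (f ⊗ₜ[k] g) • act a m

variable {ρL : H →ₐ[k] Module.End k L} {ρM : H →ₐ[k] Module.End k M}
  {ρN : H →ₐ[k] Module.End k N}

theorem PseudoAction.act_smul_left (μ : PseudoAction ρL ρM) (f : H) (a : L) (m : M) :
    μ.act (ρL f a) m = (f ⊗ₜ[k] (1 : H)) • μ.act a m := by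
  simpa using μ.act_smul f 1 a m

theorem PseudoAction.act_smul_right (μ : PseudoAction ρL ρM) (g : H) (a : L) (m : M) :
    μ.act a (ρM g m) = ((1 : H) ⊗ₜ[k] g) • μ.act a m := by
  simpa using μ.act_smul 1 g a m

theorem comul3_eq (h : H) :
    Algebra.TensorProduct.map (AlgHom.id k H) (Bialgebra.comulAlgHom k H)
      (Bialgebra.comulAlgHom k H h) = comul3 k H h := rfl

theorem comul3_eq' (h : H) :
    ((Algebra.TensorProduct.assoc k k k H H H).toAlgHom.comp
      (Algebra.TensorProduct.map (Bialgebra.comulAlgHom k H) (AlgHom.id k H)))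
      (Bialgebra.comulAlgHom k H h) = comul3 k H h :=
  Coalgebra.coassoc_apply h

/-- The map `(id ⊗ Δ) ⊗_H id : (H ⊗ H) ⊗_H M → (H ⊗ H ⊗ H) ⊗_H M`. -/
def comulSnd (ρM : H →ₐ[k] Module.End k M) : PT2 ρM →ₗ[k] PT3 ρM :=
  Bal.map ρM (Algebra.TensorProduct.map (AlgHom.id k H) (Bialgebra.comulAlgHom k H)) comul3_eq

/-- The map `(Δ ⊗ id) ⊗_H id : (H ⊗ H) ⊗_H M → (H ⊗ H ⊗ H) ⊗_H M`. -/
def comulFst (ρM : H →ₐ[k] Module.End k M) : PT2 ρM →ₗ[k] PT3 ρM :=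
  Bal.map ρM ((Algebra.TensorProduct.assoc k k k H H H).toAlgHom.comp
      (Algebra.TensorProduct.map (Bialgebra.comulAlgHom k H) (AlgHom.id k H))) comul3_eq'

theorem comulSnd_smul (ρM : H →ₐ[k] Module.End k M) (t : H ⊗[k] H) (x : PT2 ρM) :
    comulSnd ρM (t • x) =
      (Algebra.TensorProduct.map (AlgHom.id k H) (Bialgebra.comulAlgHom k H) t) •
        comulSnd ρM x :=
  Bal.map_smul _ _ _ _ _

theorem comulFst_smul (ρM : H →ₐ[k] Module.End k M) (t : H ⊗[k] H) (x : PT2 ρM) :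
    comulFst ρM (t • x) = (Algebra.TensorProduct.assoc k k k H H H
      (Algebra.TensorProduct.map (Bialgebra.comulAlgHom k H) (AlgHom.id k H) t)) •
        comulFst ρM x :=
  Bal.map_smul _ _ _ _ _

/-- The composition `a * x ∈ (H ⊗ H ⊗ H) ⊗_H M` for `x ∈ (H ⊗ H) ⊗_H M`:
if `a * d = ∑ (h ⊗ l) ⊗_H e`, then `a * ((f ⊗ g) ⊗_H d) = ∑ (h ⊗ f l₍₁₎ ⊗ g l₍₂₎) ⊗_H e`. -/
def compRight (μ : PseudoAction ρL ρM) (a : L) : PT2 ρM →ₗ[k] PT3 ρM :=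
  Bal.lift _ ρM
    (TensorProduct.lift
      (LinearMap.mk₂ k
        (fun (t : H ⊗[k] H) (d : M) => ((1 : H) ⊗ₜ[k] t) • comulSnd ρM (μ.act a d))
        (by intro s t d; rw [TensorProduct.tmul_add, add_smul])
        (by intro c t d; rw [TensorProduct.tmul_smul, smul_assoc])
        (by intro t d e; rw [map_add, map_add, smul_add])
        (by intro c t d; rw [map_smul, map_smul, smul_comm])))
    (fun t h d => by
      have : ((1 : H) ⊗ₜ[k] (t * Bialgebra.comulAlgHom k H h)) =
          ((1 : H) ⊗ₜ[k] t) * (Algebra.TensorProduct.map (AlgHom.id k H)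
            (Bialgebra.comulAlgHom k H) ((1 : H) ⊗ₜ[k] h)) := by simp
      simp only [TensorProduct.lift.tmul, LinearMap.mk₂_apply]
      rw [μ.act_smul_right]
      refine (congrArg (fun z => z • comulSnd ρM (μ.act a d)) this).trans ?_
      refine (Bal.mul_smul _ _ _).trans ?_
      rw [comulSnd_smul])

/-- The composition `x * c ∈ (H ⊗ H ⊗ H) ⊗_H M` for `x ∈ (H ⊗ H) ⊗_H L`:
if `e * c = ∑ (h ⊗ l) ⊗_H d`, then `((f ⊗ g) ⊗_H e) * c = ∑ (f h₍₁₎ ⊗ g h₍₂₎ ⊗ l) ⊗_H d`. -/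
def compLeft (μ : PseudoAction ρL ρM) (c : M) : PT2 ρL →ₗ[k] PT3 ρM :=
  Bal.lift _ ρL
    (TensorProduct.lift
      (LinearMap.mk₂ k
        (fun (t : H ⊗[k] H) (e : L) =>
          (Algebra.TensorProduct.assoc k k k H H H (t ⊗ₜ[k] (1 : H))) • comulFst ρM (μ.act e c))
        (by intro s t d; rw [TensorProduct.add_tmul, map_add, add_smul])
        (by intro c t d; rw [← TensorProduct.smul_tmul', map_smul, smul_assoc])
        (by intro t d e; rw [map_add, LinearMap.add_apply, map_add, smul_add])
        (by intro c t d; rw [map_smul, LinearMap.smul_apply, map_smul, smul_comm])))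
    (fun t h d => by
      have : (t * Bialgebra.comulAlgHom k H h) ⊗ₜ[k] (1 : H) =
          (t ⊗ₜ[k] (1 : H)) * (Algebra.TensorProduct.map
            (Bialgebra.comulAlgHom k H) (AlgHom.id k H) (h ⊗ₜ[k] (1 : H))) := by simp
      simp only [TensorProduct.lift.tmul, LinearMap.mk₂_apply]
      rw [μ.act_smul_left, this, map_mul]
      refine (Bal.mul_smul _ _ _).trans ?_
      rw [comulFst_smul])

section Tensor

theorem diag_apply_repr (ρM : H →ₐ[k] Module.End k M) (ρN : H →ₐ[k] Module.End k N) (g : H)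
    {ι : Type*} (R : Coalgebra.Repr k g ι) (m : M) (n : N) :
    diag ρM ρN g (m ⊗ₜ n) = ∑ i ∈ R.index, ρM (R.left i) m ⊗ₜ[k] ρN (R.right i) n := by
  simp only [diag, AlgHom.comp_apply, Bialgebra.comulAlgHom_apply, ← R.eq, map_sum,
    LinearMap.sum_apply]
  rfl

/-- The action map on `M ⊗ N`, with values in `(H ⊗ H) ⊗_H (M ⊗ N)`: if
`a * m = ∑ (h ⊗ 1) ⊗_H m'` and `a * n = ∑ (l ⊗ 1) ⊗_H n'`, then
`a * (m ⊗ n) = ∑ (h ⊗ 1) ⊗_H (m' ⊗ n) + ∑ (l ⊗ 1) ⊗_H (m ⊗ n')`. -/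
def tensorFun (μ : PseudoAction ρL ρM) (ν : PseudoAction ρL ρN) :
    L →ₗ[k] M ⊗[k] N →ₗ[k] PT2 (diag ρM ρN) where
  toFun a := unFourier (diag ρM ρN) ∘ₗ
    ((TensorProduct.assoc k H M N).toLinearMap ∘ₗ (fourier ρM ∘ₗ μ.act a).rTensor N +
      (TensorProduct.leftComm k M H N).toLinearMap ∘ₗ (fourier ρN ∘ₗ ν.act a).lTensor M)
  map_add' a b := by
    simp only [map_add, LinearMap.comp_add, LinearMap.rTensor_add, LinearMap.lTensor_add]
    abel
  map_smul' c a := by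
    simp only [map_smul, LinearMap.comp_smul, LinearMap.rTensor_smul, LinearMap.lTensor_smul,
      smul_add, RingHom.id_apply, LinearMap.comp_add]

/-- The summand of the action on `M ⊗ N` coming from the first factor. -/
def tensorFst (ρM : H →ₐ[k] Module.End k M) (ρN : H →ₐ[k] Module.End k N) (x : PT2 ρM) (n : N) :
    PT2 (diag ρM ρN) :=
  unFourier (diag ρM ρN) (TensorProduct.assoc k H M N (fourier ρM x ⊗ₜ n))

theorem fourierH_coassoc (p g : H) {ι : Type*} (R : Coalgebra.Repr k g ι) :
    ∑ i ∈ R.index, TensorProduct.assoc k H H H (fourierH k H (p ⊗ₜ R.left i) ⊗ₜ[k] R.right i) =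
      Coalgebra.comul.lTensor H (fourierH k H (p ⊗ₜ[k] g)) := by
  let u : H →ₗ[k] H := LinearMap.mulLeft k p ∘ₗ HopfAlgebra.antipode k
  have h0 : ∀ g : H, fourierH k H (p ⊗ₜ[k] g) =
      TensorProduct.map u LinearMap.id (Coalgebra.comul g) := by
    intro g
    rw [fourierH_tmul]
    generalize (Coalgebra.comul (R := k) g) = z
    induction z using TensorProduct.induction_on with
    | zero => simp
    | tmul x y => simp [u]
    | add x y h1 h2 => simp only [map_add, mul_add, h1, h2]
  have h1 : ∀ z : (H ⊗[k] H) ⊗[k] H, TensorProduct.assoc k H H H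
      ((TensorProduct.map u LinearMap.id).rTensor H z) =
      u.rTensor (H ⊗[k] H) (TensorProduct.assoc k H H H z) := by
    intro z
    have : (TensorProduct.assoc k H H H).toLinearMap ∘ₗ
        (TensorProduct.map u LinearMap.id).rTensor H =
      u.rTensor (H ⊗[k] H) ∘ₗ (TensorProduct.assoc k H H H).toLinearMap := by
      ext; simp
    exact LinearMap.congr_fun this z
  have h2 : ∑ i ∈ R.index,
      TensorProduct.assoc k H H H (fourierH k H (p ⊗ₜ R.left i) ⊗ₜ[k] R.right i) =
      TensorProduct.assoc k H H H ((TensorProduct.map u LinearMap.id).rTensor H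
        (Coalgebra.comul.rTensor H (Coalgebra.comul g))) := by
    rw [← R.eq]
    simp only [map_sum, LinearMap.rTensor_tmul, h0]
  rw [h2, h1, Coalgebra.coassoc_apply, h0, LinearMap.rTensor, LinearMap.lTensor,
    TensorProduct.map_map, TensorProduct.map_map]
  simp

theorem tensorFst_smul (f g : H) {ι : Type*} (R : Coalgebra.Repr k g ι) (x : PT2 ρM) (n : N) :
    ∑ i ∈ R.index, tensorFst ρM ρN ((f ⊗ₜ[k] R.left i) • x) (ρN (R.right i) n) =
      (f ⊗ₜ[k] g) • tensorFst ρM ρN x n := by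
  obtain ⟨y, rfl⟩ : ∃ y, x = unFourier ρM y := ⟨fourier ρM x, (unFourier_fourier ρM x).symm⟩
  induction y using TensorProduct.induction_on with
  | zero => simp [tensorFst]
  | add y z h1 h2 =>
    have hadd : ∀ x y n, tensorFst ρM ρN (x + y) n =
        tensorFst ρM ρN x n + tensorFst ρM ρN y n := by
      intro x y n
      simp only [tensorFst, map_add, TensorProduct.add_tmul]
    simp only [map_add, smul_add, hadd, Finset.sum_add_distrib, h1, h2]
  | tmul h m =>
    let β : H ⊗[k] H →ₗ[k] M ⊗[k] N :=
      TensorProduct.map (ρM.toLinearMap.flip m) (ρN.toLinearMap.flip n)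
    let Θ : H ⊗[k] (H ⊗[k] H) →ₗ[k] PT2 (diag ρM ρN) :=
      unFourier (diag ρM ρN) ∘ₗ β.lTensor H
    have h1 : ∀ (z : H ⊗[k] H) (w : H),
        unFourier (diag ρM ρN) (TensorProduct.assoc k H M N (actSnd ρM (z ⊗ₜ m) ⊗ₜ ρN w n)) =
        Θ (TensorProduct.assoc k H H H (z ⊗ₜ w)) := by
      intro z w
      induction z using TensorProduct.induction_on with
      | zero => simp
      | tmul u v => simp [Θ, β, actSnd, actMap]
      | add x y h1 h2 => simp only [map_add, TensorProduct.add_tmul, h1, h2]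
    have hβ : ∀ v : H, β (Coalgebra.comul v) = diag ρM ρN v (m ⊗ₜ n) := by
      intro v
      rw [diag_apply_repr ρM ρN v (Coalgebra.Repr.arbitrary k v), ← (Coalgebra.Repr.arbitrary k v).eq,
        map_sum]
      rfl
    have h2 : ∀ z : H ⊗[k] H, Θ (Coalgebra.comul.lTensor H z) =
        Bal.tmul _ (diag ρM ρN) (fourierInvH k H z) (m ⊗ₜ n) := by
      intro z
      rw [← unFourier_actSnd]
      induction z using TensorProduct.induction_on with
      | zero => simp
      | tmul u v => simp [Θ, hβ, actSnd, actMap]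
      | add x y h1 h2 => simp only [map_add, TensorProduct.add_tmul, h1, h2]
    have h3 : ∀ i, tensorFst ρM ρN ((f ⊗ₜ[k] R.left i) • unFourier ρM (h ⊗ₜ m))
        (ρN (R.right i) n) =
        Θ (TensorProduct.assoc k H H H
          (fourierH k H ((f * h) ⊗ₜ R.left i) ⊗ₜ[k] R.right i)) := by
      intro i
      rw [tensorFst, unFourier_tmul, Bal.smul_tmul, fourier_tmul, h1]
      simp
    simp only [h3]
    rw [← map_sum, fourierH_coassoc, h2, fourierInvH_fourierH, tensorFst, fourier_unFourier,
      TensorProduct.assoc_tmul, unFourier_tmul, Bal.smul_tmul]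
    simp

variable [Coalgebra.IsCocomm k H]

/-- Cocommutativity, on a Sweedler representation. -/
def reprSwap {g : H} {ι : Type*} (R : Coalgebra.Repr k g ι) : Coalgebra.Repr k g ι where
  index := R.index
  left := R.right
  right := R.left
  eq := by
    rw [← Coalgebra.comm_comul k g, ← R.eq, map_sum]
    simp

theorem comm_diag (ρM : H →ₐ[k] Module.End k M) (ρN : H →ₐ[k] Module.End k N) (h : H)
    (x : N ⊗[k] M) :
    TensorProduct.comm k N M (diag ρN ρM h x) = diag ρM ρN h (TensorProduct.comm k N M x) := by
  induction x using TensorProduct.induction_on with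
  | zero => simp
  | tmul n m =>
    rw [TensorProduct.comm_tmul, diag_apply_repr ρN ρM h (Coalgebra.Repr.arbitrary k h),
      diag_apply_repr ρM ρN h (reprSwap (Coalgebra.Repr.arbitrary k h)), map_sum]
    rfl
  | add x y h1 h2 => simp only [map_add, h1, h2]

theorem tensorSnd_eq (x : PT2 ρN) (m : M) :
    unFourier (diag ρM ρN) (TensorProduct.leftComm k M H N (m ⊗ₜ fourier ρN x)) =
      Bal.mapRight _ (TensorProduct.comm k N M).toLinearMap (comm_diag ρM ρN)
        (tensorFst ρN ρM x m) := by
  rw [tensorFst]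
  generalize fourier ρN x = y
  induction y using TensorProduct.induction_on with
  | zero => simp
  | tmul h n => rfl
  | add x y h1 h2 => simp only [map_add, TensorProduct.add_tmul, TensorProduct.tmul_add, h1, h2]

/-- The action of `L` on the tensor product `M ⊗ N` with its diagonal `H`-module structure. -/
def tensorAction (μ : PseudoAction ρL ρM) (ν : PseudoAction ρL ρN) :
    PseudoAction ρL (diag ρM ρN) where
  act := tensorFun μ ν
  act_smul f g a x := by
    induction x using TensorProduct.induction_on with
    | zero => simp
    | add x y h1 h2 => simp only [map_add, smul_add, h1, h2]
    | tmul m n =>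
      let R := Coalgebra.Repr.arbitrary k g
      have h1 : ∀ (a : L) (m : M) (n : N), tensorFun μ ν a (m ⊗ₜ n) =
          tensorFst ρM ρN (μ.act a m) n + Bal.mapRight _ (TensorProduct.comm k N M).toLinearMap
            (comm_diag ρM ρN) (tensorFst ρN ρM (ν.act a n) m) := by
        intro a m n
        rw [← tensorSnd_eq, tensorFst, ← map_add]
        rfl
      rw [diag_apply_repr ρM ρN g R, map_sum]
      simp only [h1, μ.act_smul, ν.act_smul]
      rw [Finset.sum_add_distrib, tensorFst_smul, ← map_sum, smul_add, ← Bal.mapRight_smul]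
      congr 2
      exact tensorFst_smul f g (reprSwap R) (ν.act a n) m

end Tensor

theorem comm_comulAlgHom [Coalgebra.IsCocomm k H] (h : H) :
    (Algebra.TensorProduct.comm k H H).toAlgHom (Bialgebra.comulAlgHom k H h) =
      Bialgebra.comulAlgHom k H h :=
  Coalgebra.comm_comul k h

/-- The flip `(f ⊗ g) ⊗_H m ↦ (g ⊗ f) ⊗_H m`. -/
def flip2 [Coalgebra.IsCocomm k H] (ρM : H →ₐ[k] Module.End k M) : PT2 ρM →ₗ[k] PT2 ρM :=
  Bal.map ρM (Algebra.TensorProduct.comm k H H).toAlgHom comm_comulAlgHom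

theorem leftComm_comul3 [Coalgebra.IsCocomm k H] (h : H) :
    (Algebra.TensorProduct.leftComm k H H H).toAlgHom (comul3 k H h) = comul3 k H h := by
  have h1 : comul3 k H h = (TensorProduct.assoc k H H H)
      (Coalgebra.comul.rTensor H (Coalgebra.comul (R := k) h)) :=
    (Coalgebra.coassoc_apply h).symm
  have h2 : ∀ z : (H ⊗[k] H) ⊗[k] H,
      TensorProduct.leftComm k H H H (TensorProduct.assoc k H H H z) =
      TensorProduct.assoc k H H H ((TensorProduct.comm k H H).toLinearMap.rTensor H z) := by
    intro z
    have : (TensorProduct.leftComm k H H H).toLinearMap ∘ₗ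
        (TensorProduct.assoc k H H H).toLinearMap =
      (TensorProduct.assoc k H H H).toLinearMap ∘ₗ
        (TensorProduct.comm k H H).toLinearMap.rTensor H := by
      ext; simp
    exact LinearMap.congr_fun this z
  have h3 : (TensorProduct.comm k H H).toLinearMap.rTensor H
      (Coalgebra.comul.rTensor H (Coalgebra.comul (R := k) h)) =
      Coalgebra.comul.rTensor H (Coalgebra.comul (R := k) h) := by
    rw [← LinearMap.comp_apply, ← LinearMap.rTensor_comp, Coalgebra.comm_comp_comul]
  rw [h1]
  refine (h2 _).trans ?_
  rw [h3]

/-- The flip of the first two factors, `(f ⊗ g ⊗ l) ⊗_H m ↦ (g ⊗ f ⊗ l) ⊗_H m`. -/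
def flip3 [Coalgebra.IsCocomm k H] (ρM : H →ₐ[k] Module.End k M) : PT3 ρM →ₗ[k] PT3 ρM :=
  Bal.map ρM (Algebra.TensorProduct.leftComm k H H H).toAlgHom leftComm_comul3

/-- A pseudoproduct on `L` is a Lie pseudobracket if it is skew-commutative,
`[b * a] = - (σ ⊗_H id) [a * b]`, and satisfies the Jacobi identity
`[a * [b * c]] - ((σ ⊗ id) ⊗_H id) [b * [a * c]] = [[a * b] * c]`. -/
structure IsLieBracket [Coalgebra.IsCocomm k H] (μ : PseudoAction ρL ρL) : Prop where
  skew : ∀ a b : L, μ.act b a = - flip2 ρL (μ.act a b)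
  jacobi : ∀ a b c : L,
    compRight μ a (μ.act b c) - flip3 ρL (compRight μ b (μ.act a c)) = compLeft μ c (μ.act a b)

/-- A Lie `H`-coalgebra structure on `L`: an `H`-linear map `δ : L → L ⊗ L` with skew-symmetric
values which satisfies the co-Jacobi identity `(1 ⊗ δ) δ - τ₁₂ (1 ⊗ δ) δ = (δ ⊗ 1) δ`. -/
structure IsLieCoalgebra (ρL : H →ₐ[k] Module.End k L) (δ : L →ₗ[k] L ⊗[k] L) : Prop where
  map_act : ∀ (h : H) (a : L), δ (ρL h a) = diag ρL ρL h (δ a)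
  skew : ∀ a : L, TensorProduct.comm k L L (δ a) = - δ a
  coJacobi : ∀ a : L,
    δ.lTensor L (δ a) - TensorProduct.leftComm k L L L (δ.lTensor L (δ a)) =
      TensorProduct.assoc k L L L (δ.rTensor L (δ a))

/-- `(L, [ * ], δ)` is a Lie `H`-pseudo-bialgebra: `(L, [ * ])` is a Lie pseudoalgebra, `(L, δ)` is
a Lie `H`-coalgebra, and `a * δ(b) - (σ ⊗_H 1) (b * δ(a)) = δ([a * b])`. -/
structure IsLiePseudoBialgebra [Coalgebra.IsCocomm k H] (μ : PseudoAction ρL ρL) (δ : L →ₗ[k] L ⊗[k] L) :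
    Prop where
  lie : IsLieBracket μ
  coalgebra : IsLieCoalgebra ρL δ
  cocycle : ∀ a b : L,
    (tensorAction μ μ).act a (δ b) - flip2 _ ((tensorAction μ μ).act b (δ a)) =
      Bal.mapRight _ δ coalgebra.map_act (μ.act a b)

/-- The bracket `[a, m] ∈ H ⊗ M`, that is the Fourier transform of `a * m`:
`[a, m] = ∑ h ⊗ c` if `a * m = ∑ (h ⊗ 1) ⊗_H c`. -/
def fbr (μ : PseudoAction ρL ρM) (a : L) (m : M) : H ⊗[k] M := fourier ρM (μ.act a m)

/-- The differential `d : k ⊗_H M → Hom(L, M)` of the reduced complex in degree `0`: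
`(d(1 ⊗_H m))(a) = ∑ (id ⊗ ε)(h_i) m_i` if `a * m = ∑ h_i ⊗_H m_i`. -/
def d0 (μ : PseudoAction ρL ρM) : Coinv ρM →ₗ[k] L →ₗ[k] M :=
  Bal.lift _ ρM ((μ.act.compr₂ (evalCounit ρM)).flip ∘ₗ (TensorProduct.lid k M).toLinearMap)
    (fun t h m => by
      have h1 : ∀ x : PT2 ρM, evalCounit ρM (((1 : H) ⊗ₜ[k] h) • x) =
          (Coalgebra.counit h : k) • evalCounit ρM x := by
        intro x
        induction x using Bal.induction_on with
        | add x y h1 h2 => simp only [smul_add, map_add, h1, h2]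
        | tmul s m =>
          rw [Bal.smul_tmul, evalCounit_tmul, evalCounit_tmul]
          induction s using TensorProduct.induction_on with
          | zero => simp
          | tmul u v => simp [actMap, mul_smul]
          | add x y h1 h2 => simp only [mul_add, TensorProduct.add_tmul, smul_add, map_add, h1, h2]
      ext a
      simp [μ.act_smul_right, h1, mul_smul])

/-- `δ_r = d(1 ⊗_H r) : L → L ⊗ L` for `r ∈ L ⊗ L`. -/
def coboundary [Coalgebra.IsCocomm k H] (μ : PseudoAction ρL ρL) (r : L ⊗[k] L) : L →ₗ[k] L ⊗[k] L :=
  d0 (tensorAction μ μ) (Bal.tmul _ _ 1 r)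

/-- For `x = h ⊗ c ∈ H ⊗ L` and `y ∈ L`, the element `S(h) y ⊗ c`. -/
def antiAct (ρL : H →ₐ[k] Module.End k L) (y : L) : H ⊗[k] L →ₗ[k] L ⊗[k] L :=
  (ρL.toLinearMap.flip y ∘ₗ HopfAlgebra.antipode k).rTensor L

/-- `[[r, r]]` for `r = ∑ a_i ⊗ b_i`:
`μ_{-1}^3([a_j, a_i] ⊗ b_j ⊗ b_i) - μ_{-2}^4(a_i ⊗ [a_j, b_i] ⊗ b_j)
- μ_{-3}^2(a_i ⊗ a_j ⊗ [b_j, b_i])`, summed over `i, j`. With `[x, y] = h ⊗ c` the three terms are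
`c ⊗ S(h) b_j ⊗ b_i`, `a_i ⊗ c ⊗ S(h) b_j` and `a_i ⊗ S(h) a_j ⊗ c`. -/
def yangBaxter (μ : PseudoAction ρL ρL) {ι : Type*} [Fintype ι] (a b : ι → L) :
    L ⊗[k] (L ⊗[k] L) :=
  ∑ i, ∑ j,
    (TensorProduct.assoc k L L L
        (TensorProduct.comm k L L (antiAct ρL (b j) (fbr μ (a j) (a i))) ⊗ₜ[k] b i) -
      a i ⊗ₜ[k] TensorProduct.comm k L L (antiAct ρL (b j) (fbr μ (a j) (b i))) -
      a i ⊗ₜ[k] antiAct ρL (a j) (fbr μ (b j) (b i)))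

end Hopf
end LiePseudo
end

open LiePseudo

/-! Write `x·z` for `evalAct`: let `x` act on `z` and apply `id ⊗ ε`, so that `δ_r(x) = x·r`. The
displayed formula is this definition read through the Fourier transform. The operator commutes with
permutations of tensor factors, because `H` is cocommutative; hence `x·r₂₁ = τ(x·r)`, and `δ_{r+r₂₁}
= 0` says exactly that `δ_r` is skew. Its `H`-linearity comes from that of the action in `x`. The
cocycle condition holds for every `r`: on `u ⊗ v` the Jacobi identity handles the terms in which
both elements hit the same factor, and the mixed terms cancel (`coboundary_cocycle`). Only co-Jacobi
remains.

For `p = a ⊗ b` let `actSndMap p c` be the evaluated form of `a ⊗ [c, b]`. Then `δ_r = actSndMap r +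
τ ∘ actSndMap r₂₁` (`coboundary_eq`), and skew-commutativity rewrites the three terms of `[[r,r]]`
through `actSndMap r` and `actSndMap r₂₁` applied to one factor of `r` (`yangBaxter_eq`). The key
fact is the derivation rule `evalAct_actMid`. Without `H` it reads `x·(a ⊗ [c,b] ⊗ d) = a ⊗
[[x,c],b] ⊗ d + a ⊗ [c,b] ⊗ [x,d] - [x,a] ⊗ [b,c] ⊗ d - a ⊗ [[x,b],c] ⊗ d`, which is Jacobi in the
middle factor. With `H` present, the maps `evalFst` and `evalThird` carry Jacobi from `H^{⊗3} ⊗_H L`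
to `L^{⊗3}`, and `S² = id` is needed when `x` hits a factor twisted by an antipode.

If `x·r = D` is skew, then `x·r₂₁ = -D`. Applying the rule to each term of `[[r,r]]` makes
`x·[[r,r]]` equal to the co-Jacobi expression `(1⊗δ_r)D - τ₁₂(1⊗δ_r)D - (δ_r⊗1)D`
(`coJacobi_defect`). Under condition (1), co-Jacobi is therefore the same as condition (2). -/

noncomputable section

namespace LiePseudo

/-! ### Antipode identities and the evaluation map `evalFst`. -/

section Hopf

variable {k H L M N : Type*} [CommRing k] [Ring H] [HopfAlgebra k H]
  [AddCommGroup L] [Module k L] [AddCommGroup M] [Module k M] [AddCommGroup N] [Module k N]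

-- Apply `S` to `S(h₍₁₎) h₍₂₎ = ε(h)`: since `S` reverses products and the coproduct is
-- cocommutative, `S ∘ S` is a right convolution inverse of `S`. The identity map is a left inverse,
-- so the two agree.
open WithConv in
theorem antipode_antipode [Coalgebra.IsCocomm k H] (h : H) :
    HopfAlgebra.antipode k (HopfAlgebra.antipode k h) = h := by
  let S : H →ₗ[k] H := HopfAlgebra.antipode k
  have h1 : toConv S * toConv (S ∘ₗ S) = 1 := by
    ext h
    have h2 : LinearMap.mul' k H ∘ₗ TensorProduct.map S (S ∘ₗ S) =
        S ∘ₗ LinearMap.mul' k H ∘ₗ S.rTensor H ∘ₗ (TensorProduct.comm k H H).toLinearMap := by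
      ext x y
      simp [S, HopfAlgebra.antipode_mul_antidistrib]
    have h3 := LinearMap.congr_fun h2 (Coalgebra.comul h)
    simp only [LinearMap.comp_apply, LinearEquiv.coe_coe, Coalgebra.comm_comul, S,
      HopfAlgebra.mul_antipode_rTensor_comul_apply, Algebra.algebraMap_eq_smul_one, map_smul,
      HopfAlgebra.antipode_one] at h3
    simpa [LinearMap.convMul_def, Algebra.algebraMap_eq_smul_one, S] using h3
  have h2 := left_inv_eq_right_inv (LinearMap.id_mul_antipode (R := k) (C := H)) h1
  exact (LinearMap.congr_fun (toConv_injective h2) h).symm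

/-- `∑ h₍₁₎ ⊗ h₍₂₎ S(h₍₃₎) = h ⊗ 1`. -/
theorem comul_mul_antipode (h : H) {ι : Type*} (R : Coalgebra.Repr k h ι) :
    ∑ i ∈ R.index, Coalgebra.comul (R.left i) *
      ((1 : H) ⊗ₜ[k] HopfAlgebra.antipode k (R.right i)) = h ⊗ₜ[k] (1 : H) := by
  have h1 : ∀ (z : H ⊗[k] H) (g : H), z * ((1 : H) ⊗ₜ[k] HopfAlgebra.antipode k g) =
      (LinearMap.mul' k H ∘ₗ (HopfAlgebra.antipode k).lTensor H).lTensor H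
        (TensorProduct.assoc k H H H (z ⊗ₜ g)) := by
    intro z g
    induction z using TensorProduct.induction_on with
    | zero => simp
    | tmul x y => simp
    | add x y h1 h2 => simp only [add_mul, TensorProduct.add_tmul, map_add, h1, h2]
  have h2 : (LinearMap.mul' k H ∘ₗ (HopfAlgebra.antipode k).lTensor H) ∘ₗ Coalgebra.comul =
      Algebra.linearMap k H ∘ₗ Coalgebra.counit := by
    ext g
    exact HopfAlgebra.mul_antipode_lTensor_comul_apply g
  have h3 : ∑ i ∈ R.index, (Coalgebra.comul (R := k) (R.left i)) ⊗ₜ[k] R.right i =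
      Coalgebra.comul.rTensor H (Coalgebra.comul (R := k) h) := by
    rw [← R.eq, map_sum]; rfl
  simp only [h1]
  rw [← map_sum, ← map_sum, h3, Coalgebra.coassoc_apply, ← LinearMap.comp_apply,
    ← LinearMap.lTensor_comp, h2, LinearMap.lTensor_comp, LinearMap.comp_apply,
    Coalgebra.lTensor_counit_comul]
  simp

theorem diag_tmul_eq (ρM : H →ₐ[k] Module.End k M) (ρN : H →ₐ[k] Module.End k N) (f g : H)
    (m : M) (n : N) :
    diag ρM ρN f (m ⊗ₜ ρN g n) = TensorProduct.map (ρM.toLinearMap.flip m) (ρN.toLinearMap.flip n)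
      (Coalgebra.comul f * ((1 : H) ⊗ₜ[k] g)) := by
  rw [diag_apply_repr ρM ρN f (Coalgebra.Repr.arbitrary k f)]
  conv_rhs => rw [← (Coalgebra.Repr.arbitrary k f).eq]
  simp [Finset.sum_mul]

/-- `∑ h₍₁₎ (m ⊗ S(h₍₂₎) n) = h m ⊗ n`. -/
theorem sum_diag_antipode (ρM : H →ₐ[k] Module.End k M) (ρN : H →ₐ[k] Module.End k N) (h : H)
    {ι : Type*} (R : Coalgebra.Repr k h ι) (m : M) (n : N) :
    ∑ i ∈ R.index, diag ρM ρN (R.left i) (m ⊗ₜ ρN (HopfAlgebra.antipode k (R.right i)) n) =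
      ρM h m ⊗ₜ n := by
  simp only [diag_tmul_eq]
  rw [← map_sum, comul_mul_antipode]
  simp

/-- The map `(f ⊗ g) ⊗_H m ↦ f (m ⊗ S(g) n)`. -/
def evalFst (ρM : H →ₐ[k] Module.End k M) (ρN : H →ₐ[k] Module.End k N) (n : N) :
    PT2 ρM →ₗ[k] M ⊗[k] N :=
  Bal.lift _ ρM
    (actMap (diag ρM ρN) ∘ₗ ((TensorProduct.comm k N M).toLinearMap ∘ₗ
      (ρN.toLinearMap.flip n ∘ₗ HopfAlgebra.antipode k).rTensor M).lTensor H ∘ₗ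
      (TensorProduct.assoc k H H M).toLinearMap)
    (fun t h m => by
      induction t using TensorProduct.induction_on with
      | zero => simp
      | add x y h1 h2 => simp only [add_mul, TensorProduct.add_tmul, map_add, h1, h2]
      | tmul f g =>
        -- Since `S(g h₍₂₎) = S(h₍₂₎) S(g)`, balancedness is the identity `∑ h₍₁₎(m ⊗ S(h₍₂₎) n) = h
        -- m ⊗ n` with `S(g) n` in place of `n`.
        have h1 := congrArg (diag ρM ρN f) (sum_diag_antipode ρM ρN h
          (Coalgebra.Repr.arbitrary k h) m (ρN (HopfAlgebra.antipode k g) n))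
        rw [Bialgebra.comulAlgHom_apply, ← (Coalgebra.Repr.arbitrary k h).eq]
        simp only [Finset.mul_sum, Algebra.TensorProduct.tmul_mul_tmul, TensorProduct.sum_tmul,
          map_sum] at h1 ⊢
        simpa [actMap, HopfAlgebra.antipode_mul_antidistrib] using h1)

theorem evalFst_tmul (ρM : H →ₐ[k] Module.End k M) (ρN : H →ₐ[k] Module.End k N) (n : N)
    (f g : H) (m : M) :
    evalFst ρM ρN n (Bal.tmul _ ρM (f ⊗ₜ g) m) =
      diag ρM ρN f (m ⊗ₜ ρN (HopfAlgebra.antipode k g) n) := rfl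

end Hopf

/-! ### Naturality of the evaluation maps, and the Jacobi identity seen through them. -/

section Hopf

variable {k H L M N N' : Type*} [CommRing k] [Ring H] [HopfAlgebra k H]
  [AddCommGroup L] [Module k L] [AddCommGroup M] [Module k M] [AddCommGroup N] [Module k N]
  [AddCommGroup N'] [Module k N']
  {ρL : H →ₐ[k] Module.End k L} {ρM : H →ₐ[k] Module.End k M}
  {ρN : H →ₐ[k] Module.End k N} {ρN' : H →ₐ[k] Module.End k N'}

/-- Fourier inversion reduces everything to generators with second entry `1`, on which `evalFst`
involves no antipode. -/
theorem PT2.induction_on {p : PT2 ρM → Prop} (x : PT2 ρM)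
    (tmul : ∀ (h : H) m, p (Bal.tmul _ ρM (h ⊗ₜ 1) m)) (add : ∀ x y, p x → p y → p (x + y)) :
    p x := by
  rw [← unFourier_fourier ρM x]
  induction fourier ρM x using TensorProduct.induction_on with
  | zero => simpa [Bal.tmul] using tmul 0 0
  | tmul h m => exact tmul h m
  | add x y h1 h2 => rw [map_add]; exact add _ _ h1 h2

theorem tmul_comul (t : H ⊗[k] H) (h : H) (m : M) :
    Bal.tmul _ ρM (t * Coalgebra.comul h) m = Bal.tmul (Bialgebra.comulAlgHom k H) ρM t (ρM h m) :=
  Bal.tmul_balanced (Bialgebra.comulAlgHom k H) ρM t h m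

theorem fourier_tmul_one (h : H) (m : M) :
    fourier ρM (Bal.tmul _ ρM (h ⊗ₜ 1) m) = h ⊗ₜ m :=
  fourier_unFourier ρM (h ⊗ₜ m)

theorem tensorFst_tmul (h : H) (m : M) (n : N) :
    tensorFst ρM ρN (Bal.tmul _ ρM (h ⊗ₜ 1) m) n =
      Bal.tmul _ (diag ρM ρN) (h ⊗ₜ 1) (m ⊗ₜ n) := by
  rw [tensorFst, fourier_tmul_one]; rfl

theorem tensorFst_add (x y : PT2 ρM) (n : N) :
    tensorFst ρM ρN (x + y) n = tensorFst ρM ρN x n + tensorFst ρM ρN y n := by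
  simp only [tensorFst, map_add, TensorProduct.add_tmul]

theorem evalFst_smul_left (n : N) (f : H) (x : PT2 ρM) :
    evalFst ρM ρN n ((f ⊗ₜ[k] (1 : H)) • x) = diag ρM ρN f (evalFst ρM ρN n x) := by
  induction x using PT2.induction_on with
  | tmul h m => simp [Bal.smul_tmul, evalFst_tmul]
  | add x y h1 h2 => simp only [smul_add, map_add, h1, h2]

theorem evalFst_smul_right (n : N) (g : H) (x : PT2 ρM) :
    evalFst ρM ρN n (((1 : H) ⊗ₜ[k] g) • x) =
      evalFst ρM ρN (ρN (HopfAlgebra.antipode k g) n) x := by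
  induction x using PT2.induction_on with
  | tmul h m => simp [Bal.smul_tmul, evalFst_tmul]
  | add x y h1 h2 => simp only [smul_add, map_add, h1, h2]

theorem evalFst_add (m n : N) (x : PT2 ρM) :
    evalFst ρM ρN (m + n) x = evalFst ρM ρN m x + evalFst ρM ρN n x := by
  induction x using PT2.induction_on with
  | tmul h m => simp [evalFst_tmul, TensorProduct.tmul_add]
  | add x y h1 h2 => simp only [map_add, h1, h2]; abel

theorem evalFst_zero (x : PT2 ρM) : evalFst ρM ρN 0 x = 0 := by
  simpa using evalFst_add (ρM := ρM) (ρN := ρN) 0 0 x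

theorem evalFst_smul (c : k) (n : N) (x : PT2 ρM) :
    evalFst ρM ρN (c • n) x = c • evalFst ρM ρN n x := by
  induction x using PT2.induction_on with
  | tmul h m => simp [evalFst_tmul]
  | add x y h1 h2 => simp only [map_add, h1, h2, smul_add]

theorem diag_map (φ : M →ₗ[k] N') (hφ : ∀ h m, φ (ρM h m) = ρN' h (φ m)) (h : H) (z : M ⊗[k] N) :
    φ.rTensor N (diag ρM ρN h z) = diag ρN' ρN h (φ.rTensor N z) := by
  induction z using TensorProduct.induction_on with
  | zero => simp
  | tmul m n =>
    simp [diag_apply_repr _ _ h (Coalgebra.Repr.arbitrary k h), hφ]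
  | add x y h1 h2 => simp only [map_add, h1, h2]

theorem diag_map_right (φ : N →ₗ[k] N') (hφ : ∀ h m, φ (ρN h m) = ρN' h (φ m)) (h : H)
    (z : M ⊗[k] N) :
    φ.lTensor M (diag ρM ρN h z) = diag ρM ρN' h (φ.lTensor M z) := by
  induction z using TensorProduct.induction_on with
  | zero => simp
  | tmul m n =>
    simp [diag_apply_repr _ _ h (Coalgebra.Repr.arbitrary k h), hφ]
  | add x y h1 h2 => simp only [map_add, h1, h2]

/-- `evalFst` is natural in its module argument. -/
theorem evalFst_mapRight (φ : M →ₗ[k] N') (hφ : ∀ h m, φ (ρM h m) = ρN' h (φ m)) (n : N)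
    (x : PT2 ρM) :
    evalFst ρN' ρN n (Bal.mapRight _ φ hφ x) = φ.rTensor N (evalFst ρM ρN n x) := by
  induction x using PT2.induction_on with
  | tmul h m => simp [Bal.mapRight_tmul, evalFst_tmul, diag_map φ hφ]
  | add x y h1 h2 => simp only [map_add, h1, h2]

/-- `evalFst` is natural in its parameter. -/
theorem evalFst_map (φ : N →ₗ[k] N') (hφ : ∀ h m, φ (ρN h m) = ρN' h (φ m)) (n : N)
    (x : PT2 ρM) :
    evalFst ρM ρN' (φ n) x = φ.lTensor M (evalFst ρM ρN n x) := by
  induction x using PT2.induction_on with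
  | tmul h m => simp [evalFst_tmul, diag_map_right φ hφ]
  | add x y h1 h2 => simp only [map_add, h1, h2]

theorem evalCounit_tmul_one (h : H) (m : M) :
    evalCounit ρM (Bal.tmul _ ρM (h ⊗ₜ 1) m) = ρM h m := by
  simp [evalCounit_tmul, actMap]

theorem evalCounit_unFourier (y : H ⊗[k] M) : evalCounit ρM (unFourier ρM y) = actMap ρM y := by
  induction y using TensorProduct.induction_on with
  | zero => simp
  | tmul h m => rw [unFourier_tmul, evalCounit_tmul_one]; rfl
  | add x y h1 h2 => simp only [map_add, h1, h2]

theorem evalCounit_eq (x : PT2 ρM) : evalCounit ρM x = actMap ρM (fourier ρM x) := by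
  rw [← evalCounit_unFourier, unFourier_fourier]

theorem evalCounit_smul_left (f : H) (x : PT2 ρM) :
    evalCounit ρM ((f ⊗ₜ[k] (1 : H)) • x) = ρM f (evalCounit ρM x) := by
  induction x using PT2.induction_on with
  | tmul h m => simp [Bal.smul_tmul, evalCounit_tmul_one]
  | add x y h1 h2 => simp only [smul_add, map_add, h1, h2]

theorem evalCounit_mapRight (φ : M →ₗ[k] N') (hφ : ∀ h m, φ (ρM h m) = ρN' h (φ m))
    (x : PT2 ρM) :
    evalCounit ρN' (Bal.mapRight _ φ hφ x) = φ (evalCounit ρM x) := by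
  induction x using PT2.induction_on with
  | tmul h m => simp [Bal.mapRight_tmul, evalCounit_tmul_one, hφ]
  | add x y h1 h2 => simp only [map_add, h1, h2]

/-- This is the purpose of `evalFst`: it computes the contribution of the first factor to the
evaluated action on `M ⊗ N`. -/
theorem evalCounit_tensorFst (x : PT2 ρM) (n : N) :
    evalCounit (diag ρM ρN) (tensorFst ρM ρN x n) = evalFst ρM ρN n x := by
  induction x using PT2.induction_on with
  | tmul h m => simp [tensorFst_tmul, evalCounit_tmul_one, evalFst_tmul]
  | add x y h1 h2 => simp only [tensorFst_add, map_add, h1, h2]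

/-- The map `(f ⊗ g ⊗ u) ⊗_H m ↦ (f ⊗ g) ⊗_H (m ⊗ S(u) n)`. -/
def evalThird (ρM : H →ₐ[k] Module.End k M) (ρN : H →ₐ[k] Module.End k N) (n : N) :
    PT3 ρM →ₗ[k] PT2 (diag ρM ρN) :=
  Bal.lift _ ρM
    ((Bal.proj _ (diag ρM ρN)).restrictScalars k ∘ₗ
      ((TensorProduct.comm k N M).toLinearMap ∘ₗ
        (ρN.toLinearMap.flip n ∘ₗ HopfAlgebra.antipode k).rTensor M).lTensor (H ⊗[k] H) ∘ₗ
      (TensorProduct.assoc k (H ⊗[k] H) H M).toLinearMap ∘ₗ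
      (TensorProduct.assoc k H H H).symm.toLinearMap.rTensor M)
    (fun t h m => by
      obtain ⟨t, rfl⟩ := (Algebra.TensorProduct.assoc k k k H H H).surjective t
      induction t using TensorProduct.induction_on with
      | zero => simp
      | add x y h1 h2 => simp only [map_add, add_mul, TensorProduct.add_tmul, h1, h2]
      | tmul t u =>
        have h1 := congrArg (Bal.tmul (Bialgebra.comulAlgHom k H) (diag ρM ρN) t)
          (sum_diag_antipode ρM ρN h
            (Coalgebra.Repr.arbitrary k h) m (ρN (HopfAlgebra.antipode k u) n))
        -- Regrouped as `(Δ ⊗ id)Δ`, the iterated coproduct lets `Δ(h₍₁₎)` pass through `⊗_H`, while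
        -- `h₍₂₎` meets the antipode; the same cancellation as for `evalFst` then applies.
        have h2 : comul3 k H h = Algebra.TensorProduct.assoc k k k H H H
            (∑ i ∈ (Coalgebra.Repr.arbitrary k h).index,
              (Coalgebra.comul ((Coalgebra.Repr.arbitrary k h).left i)) ⊗ₜ[k]
                (Coalgebra.Repr.arbitrary k h).right i) := by
          rw [← comul3_eq' h, Bialgebra.comulAlgHom_apply]
          conv_lhs => rw [← (Coalgebra.Repr.arbitrary k h).eq]
          simp only [map_sum]
          rfl
        have h3 : ∀ (s : (H ⊗[k] H) ⊗[k] H),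
            (TensorProduct.assoc k H H H).symm (Algebra.TensorProduct.assoc k k k H H H s) = s :=
          fun s => (TensorProduct.assoc k H H H).symm_apply_apply s
        have h4 : Bal.tmul (Bialgebra.comulAlgHom k H) (diag ρM ρN) t
            (∑ i ∈ (Coalgebra.Repr.arbitrary k h).index,
              diag ρM ρN ((Coalgebra.Repr.arbitrary k h).left i)
                (m ⊗ₜ ρN (HopfAlgebra.antipode k ((Coalgebra.Repr.arbitrary k h).right i))
                  (ρN (HopfAlgebra.antipode k u) n))) =
            ∑ i ∈ (Coalgebra.Repr.arbitrary k h).index,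
              Bal.tmul _ (diag ρM ρN) (t * Coalgebra.comul ((Coalgebra.Repr.arbitrary k h).left i))
                (m ⊗ₜ ρN (HopfAlgebra.antipode k ((Coalgebra.Repr.arbitrary k h).right i))
                  (ρN (HopfAlgebra.antipode k u) n)) := by
          simp only [tmul_comul]
          simp only [Bal.tmul, TensorProduct.tmul_sum, map_sum]
        rw [h4] at h1
        rw [h2, ← map_mul, Finset.mul_sum]
        simp only [Algebra.TensorProduct.tmul_mul_tmul, LinearMap.comp_apply,
          LinearMap.rTensor_tmul, LinearEquiv.coe_coe, h3, TensorProduct.sum_tmul, map_sum,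
          TensorProduct.assoc_tmul, LinearMap.lTensor_tmul, TensorProduct.comm_tmul,
          HopfAlgebra.antipode_mul_antidistrib, LinearMap.flip_apply, AlgHom.toLinearMap_apply,
          map_mul, Module.End.mul_apply]
        exact h1)

theorem evalThird_assoc (n : N) (t : H ⊗[k] H) (u : H) (m : M) :
    evalThird ρM ρN n (Bal.tmul _ ρM (Algebra.TensorProduct.assoc k k k H H H (t ⊗ₜ u)) m) =
      Bal.tmul _ (diag ρM ρN) t (m ⊗ₜ ρN (HopfAlgebra.antipode k u) n) := by
  have h3 : ∀ (s : (H ⊗[k] H) ⊗[k] H),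
      (TensorProduct.assoc k H H H).symm (Algebra.TensorProduct.assoc k k k H H H s) = s :=
    fun s => (TensorProduct.assoc k H H H).symm_apply_apply s
  refine (Bal.lift_tmul _ _ _ _ _ _).trans ?_
  simp only [LinearMap.comp_apply, LinearMap.rTensor_tmul, LinearEquiv.coe_coe, h3]
  rfl

theorem evalThird_tmul (n : N) (f g u : H) (m : M) :
    evalThird ρM ρN n (Bal.tmul _ ρM (f ⊗ₜ (g ⊗ₜ u)) m) =
      Bal.tmul _ (diag ρM ρN) (f ⊗ₜ g) (m ⊗ₜ ρN (HopfAlgebra.antipode k u) n) := rfl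

/-- With `a * m = (g ⊗ 1) ⊗_H m'` the composition is `(g ⊗ h ⊗ 1) ⊗_H m'`. Its third entry is `1`,
so `n` enters untwisted. -/
theorem evalThird_compRight (μ : PseudoAction ρL ρM) (a : L) (n : N) (h : H) (m : M) :
    evalThird ρM ρN n (compRight μ a (Bal.tmul _ ρM (h ⊗ₜ 1) m)) =
      ((1 : H) ⊗ₜ[k] h) • tensorFst ρM ρN (μ.act a m) n := by
  have h1 : compRight μ a (Bal.tmul _ ρM (h ⊗ₜ 1) m) =
    ((1 : H) ⊗ₜ[k] (h ⊗ₜ[k] (1 : H))) • comulSnd ρM (μ.act a m) := rfl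
  rw [h1]
  induction μ.act a m using PT2.induction_on with
  | tmul g m =>
    rw [tensorFst_tmul, comulSnd, Bal.map_tmul, Bal.smul_tmul, Bal.smul_tmul]
    simp [evalThird_tmul, Algebra.TensorProduct.one_def]
  | add x y h1 h2 => simp only [map_add, smul_add, tensorFst_add, h1, h2]

/-- The map `c ↦ evalFst n (c * m)`. -/
def actFst (μ : PseudoAction ρL ρM) (ρN : H →ₐ[k] Module.End k N) (m : M) (n : N) :
    L →ₗ[k] M ⊗[k] N :=
  evalFst ρM ρN n ∘ₗ μ.act.flip m

theorem actFst_smul (μ : PseudoAction ρL ρM) (m : M) (n : N) (h : H) (c : L) :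
    actFst μ ρN m n (ρL h c) = diag ρM ρN h (actFst μ ρN m n c) := by
  simp [actFst, μ.act_smul_left, evalFst_smul_left]

/-- With `e * m = (h ⊗ 1) ⊗_H m'`, the composition of `(l ⊗ 1) ⊗_H e` with `m` is `(l h₍₁₎ ⊗ h₍₂₎ ⊗
1) ⊗_H m'`. Balancing moves `Δ(h)` onto `m' ⊗ n`, which produces `evalFst`. -/
theorem evalThird_compLeft (μ : PseudoAction ρL ρM) (m : M) (n : N) (x : PT2 ρL) :
    evalThird ρM ρN n (compLeft μ m x) =
      Bal.mapRight _ (actFst μ ρN m n) (actFst_smul μ m n) x := by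
  induction x using PT2.induction_on with
  | add x y h1 h2 => simp only [map_add, h1, h2]
  | tmul l e =>
    have h1 : compLeft μ m (Bal.tmul _ ρL (l ⊗ₜ 1) e) =
      (l ⊗ₜ[k] ((1 : H) ⊗ₜ[k] (1 : H))) • comulFst ρM (μ.act e m) := rfl
    rw [h1, Bal.mapRight_tmul, actFst, LinearMap.comp_apply, LinearMap.flip_apply]
    induction μ.act e m using PT2.induction_on with
    | add x y h1 h2 => simp only [map_add, smul_add, Bal.tmul_add, h1, h2]
    | tmul h m =>
      rw [evalFst_tmul, ← tmul_comul, comulFst, Bal.map_tmul, Bal.smul_tmul]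
      have h2 : (l ⊗ₜ[k] ((1 : H) ⊗ₜ[k] (1 : H))) =
        Algebra.TensorProduct.assoc k k k H H H ((l ⊗ₜ[k] (1 : H)) ⊗ₜ[k] (1 : H)) := rfl
      have h3 : ∀ z, (Algebra.TensorProduct.assoc k k k H H H).toAlgHom z =
        Algebra.TensorProduct.assoc k k k H H H z := fun _ => rfl
      rw [h2, AlgHom.comp_apply, h3, ← map_mul,
        Algebra.TensorProduct.map_tmul, Algebra.TensorProduct.tmul_mul_tmul, evalThird_assoc]
      simp

section Cocomm

variable [Coalgebra.IsCocomm k H]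

theorem flip2_tmul (t : H ⊗[k] H) (m : M) :
    flip2 ρM (Bal.tmul _ ρM t m) = Bal.tmul _ ρM (TensorProduct.comm k H H t) m := rfl

theorem flip2_flip2 (x : PT2 ρM) : flip2 ρM (flip2 ρM x) = x := by
  induction x using PT2.induction_on with
  | tmul h m => simp [flip2_tmul]
  | add x y h1 h2 => simp only [map_add, h1, h2]

theorem flip2_smul (f g : H) (x : PT2 ρM) :
    flip2 ρM ((f ⊗ₜ[k] g) • x) = (g ⊗ₜ[k] f) • flip2 ρM x :=
  Bal.map_smul _ _ _ _ _

theorem flip2_mapRight (φ : M →ₗ[k] N') (hφ : ∀ h m, φ (ρM h m) = ρN' h (φ m))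
    (x : PT2 ρM) :
    flip2 ρN' (Bal.mapRight _ φ hφ x) = Bal.mapRight _ φ hφ (flip2 ρM x) := by
  induction x using PT2.induction_on with
  | tmul h m => rfl
  | add x y h1 h2 => simp only [map_add, h1, h2]

theorem evalThird_flip3 (n : N) (x : PT3 ρM) :
    evalThird ρM ρN n (flip3 ρM x) = flip2 _ (evalThird ρM ρN n x) := by
  induction x using Bal.induction_on with
  | add x y h1 h2 => simp only [map_add, h1, h2]
  | tmul t m =>
    induction t using TensorProduct.induction_on with
    | zero => simp [Bal.tmul]
    | add x y h1 h2 => simp only [Bal.add_tmul, map_add, h1, h2]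
    | tmul f t =>
      induction t using TensorProduct.induction_on with
      | zero => simp [Bal.tmul]
      | add x y h1 h2 => simp only [TensorProduct.tmul_add, Bal.add_tmul, map_add, h1, h2]
      | tmul g u => rfl

/-- The Jacobi identity, read on the first factor of `L ⊗ N`. -/
theorem evalThird_jacobi {μ : PseudoAction ρL ρL} (hμ : IsLieBracket μ) (a b c : L) (n : N) :
    evalThird ρL ρN n (compRight μ a (μ.act b c)) -
        flip2 _ (evalThird ρL ρN n (compRight μ b (μ.act a c))) =
      Bal.mapRight _ (actFst μ ρN c n) (actFst_smul μ c n) (μ.act a b) := by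
  rw [← evalThird_compLeft, ← hμ.jacobi, map_sub, evalThird_flip3]

end Cocomm
end Hopf

/-! ### The evaluated action on tensor products; `δ_r` as a 1-cocycle. -/

section Hopf

variable {k H L M N P : Type*} [CommRing k] [Ring H] [HopfAlgebra k H]
  [AddCommGroup L] [Module k L] [AddCommGroup M] [Module k M] [AddCommGroup N] [Module k N]
  [AddCommGroup P] [Module k P]
  {ρL : H →ₐ[k] Module.End k L} {ρM : H →ₐ[k] Module.End k M}
  {ρN : H →ₐ[k] Module.End k N} {ρP : H →ₐ[k] Module.End k P}

/-- The operator `m ↦ d(1 ⊗_H m)(a)`, that is `m ↦ ∑ h m'` if `a * m = ∑ (h ⊗ 1) ⊗_H m'`. -/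
def evalAct (μ : PseudoAction ρL ρM) (a : L) : M →ₗ[k] M :=
  evalCounit ρM ∘ₗ μ.act a

theorem d0_tmul (μ : PseudoAction ρL ρM) (m : M) (a : L) :
    d0 μ (Bal.tmul _ _ 1 m) a = evalAct μ a m := by
  simp [d0, Bal.lift_tmul, evalAct]

theorem actMap_fbr (μ : PseudoAction ρL ρM) (a : L) (m : M) :
    actMap ρM (fbr μ a m) = evalAct μ a m :=
  (evalCounit_eq _).symm

theorem evalAct_smul_left (μ : PseudoAction ρL ρM) (h : H) (a : L) (m : M) :
    evalAct μ (ρL h a) m = ρM h (evalAct μ a m) := by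
  simp [evalAct, μ.act_smul_left, evalCounit_smul_left]

theorem map_flip_comul (ρM : H →ₐ[k] Module.End k M) (ρN : H →ₐ[k] Module.End k N) (h : H)
    (m : M) (n : N) :
    TensorProduct.map (ρM.toLinearMap.flip m) (ρN.toLinearMap.flip n) (Coalgebra.comul h) =
      diag ρM ρN h (m ⊗ₜ n) := by
  have h1 := diag_tmul_eq ρM ρN h 1 m n
  rw [← Algebra.TensorProduct.one_def, mul_one, map_one] at h1
  exact h1.symm

/-- Coassociativity, transported along the three orbit maps `h ↦ h m`, `h ↦ h n`, `h ↦ h p`. -/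
theorem diag_assoc (h : H) (z : (M ⊗[k] N) ⊗[k] P) :
    TensorProduct.assoc k M N P (diag (diag ρM ρN) ρP h z) =
      diag ρM (diag ρN ρP) h (TensorProduct.assoc k M N P z) := by
  induction z using TensorProduct.induction_on with
  | zero => simp
  | add x y h1 h2 => simp only [map_add, h1, h2]
  | tmul z p =>
    induction z using TensorProduct.induction_on with
    | zero => simp
    | add x y h1 h2 => simp only [TensorProduct.add_tmul, map_add, h1, h2]
    | tmul m n =>
      let u : H →ₗ[k] M := ρM.toLinearMap.flip m
      let v : H →ₗ[k] N := ρN.toLinearMap.flip n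
      let w : H →ₗ[k] P := ρP.toLinearMap.flip p
      have h1 : ∀ h : H, TensorProduct.map u v (Coalgebra.comul h) = diag ρM ρN h (m ⊗ₜ n) :=
        fun h => map_flip_comul ρM ρN h m n
      have h2 : ∀ h : H, TensorProduct.map v w (Coalgebra.comul h) = diag ρN ρP h (n ⊗ₜ p) :=
        fun h => map_flip_comul ρN ρP h n p
      let R := Coalgebra.Repr.arbitrary k h
      rw [diag_apply_repr _ _ h R, TensorProduct.assoc_tmul, diag_apply_repr _ _ h R]
      have h3 := congrArg (TensorProduct.map u (TensorProduct.map v w))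
        (Coalgebra.coassoc_apply (R := k) h)
      rw [TensorProduct.map_map_assoc, ← R.eq] at h3
      simp only [map_sum, LinearMap.rTensor_tmul, LinearMap.lTensor_tmul,
        TensorProduct.map_tmul, h1, h2] at h3
      rw [map_sum]
      exact h3

/-- The bilinear map `((h ⊗ 1) ⊗_H m, (g ⊗ 1) ⊗_H n) ↦ (g ⊗ h) ⊗_H (m ⊗ n)`. -/
def cross (ρM : H →ₐ[k] Module.End k M) (ρN : H →ₐ[k] Module.End k N) :
    PT2 ρM →ₗ[k] PT2 ρN →ₗ[k] PT2 (diag ρM ρN) :=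
  (TensorProduct.mk k (H ⊗[k] M) (H ⊗[k] N)).compr₂
    ((Bal.proj _ (diag ρM ρN)).restrictScalars k ∘ₗ
      (TensorProduct.comm k H H).toLinearMap.rTensor (M ⊗[k] N) ∘ₗ
      (TensorProduct.tensorTensorTensorComm k H M H N).toLinearMap) |>.compl₁₂
    (fourier ρM) (fourier ρN)

theorem cross_tmul (h g : H) (m : M) (n : N) :
    cross ρM ρN (Bal.tmul _ ρM (h ⊗ₜ 1) m) (Bal.tmul _ ρN (g ⊗ₜ 1) n) =
      Bal.tmul _ (diag ρM ρN) (g ⊗ₜ h) (m ⊗ₜ n) := by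
  simp [cross, fourier_tmul_one]; rfl

theorem mapRight_add {φ φ₁ φ₂ : M →ₗ[k] N} (hφ : ∀ h m, φ (ρM h m) = ρN h (φ m))
    (hφ₁ : ∀ h m, φ₁ (ρM h m) = ρN h (φ₁ m)) (hφ₂ : ∀ h m, φ₂ (ρM h m) = ρN h (φ₂ m))
    (h : ∀ m, φ m = φ₁ m + φ₂ m) (x : PT2 ρM) :
    Bal.mapRight _ φ hφ x = Bal.mapRight _ φ₁ hφ₁ x + Bal.mapRight _ φ₂ hφ₂ x := by
  induction x using PT2.induction_on with
  | tmul g m => simp only [Bal.mapRight_tmul, h, Bal.tmul_add]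
  | add x y h1 h2 => simp only [map_add, h1, h2]; abel

/-- The map `c ↦ ∑ h (a ⊗ e)` if `c * b = ∑ (h ⊗ 1) ⊗_H e`, for `p = a ⊗ b`. -/
def actSndMap (μ : PseudoAction ρL ρL) : L ⊗[k] L →ₗ[k] L →ₗ[k] L ⊗[k] L :=
  TensorProduct.lift (LinearMap.mk₂ k
    (fun a b => (TensorProduct.comm k L L).toLinearMap ∘ₗ actFst μ ρL b a)
    (by intros; ext; simp [actFst, evalFst_add])
    (by intros; ext; simp [actFst, evalFst_smul])
    (by intros; ext; simp [actFst])
    (by intros; ext; simp [actFst]))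

theorem actSndMap_tmul (μ : PseudoAction ρL ρL) (a b c : L) :
    actSndMap μ (a ⊗ₜ b) c = TensorProduct.comm k L L (evalFst ρL ρL a (μ.act c b)) := rfl

section Cocomm

variable [Coalgebra.IsCocomm k H]

theorem tensorAction_tmul (μ : PseudoAction ρL ρM) (ν : PseudoAction ρL ρN) (a : L) (m : M)
    (n : N) :
    (tensorAction μ ν).act a (m ⊗ₜ n) = tensorFst ρM ρN (μ.act a m) n +
      Bal.mapRight _ (TensorProduct.comm k N M).toLinearMap (comm_diag ρM ρN)
        (tensorFst ρN ρM (ν.act a n) m) := by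
  rw [← tensorSnd_eq, tensorFst, ← map_add]
  rfl

theorem evalAct_tmul (μ : PseudoAction ρL ρM) (ν : PseudoAction ρL ρN) (a : L) (m : M) (n : N) :
    evalAct (tensorAction μ ν) a (m ⊗ₜ n) = evalFst ρM ρN n (μ.act a m) +
      TensorProduct.comm k N M (evalFst ρN ρM m (ν.act a n)) := by
  rw [evalAct, LinearMap.comp_apply, tensorAction_tmul, map_add, evalCounit_tensorFst,
    evalCounit_mapRight, evalCounit_tensorFst]
  rfl

theorem mapRight_comm_comm (x : PT2 (diag ρM ρN)) :
    Bal.mapRight _ (TensorProduct.comm k N M).toLinearMap (comm_diag ρM ρN)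
      (Bal.mapRight _ (TensorProduct.comm k M N).toLinearMap (comm_diag ρN ρM) x) = x := by
  induction x using PT2.induction_on with
  | tmul h m => simp [Bal.mapRight_tmul]
  | add x y h1 h2 => simp only [map_add, h1, h2]

theorem tensorAction_comm (μ : PseudoAction ρL ρM) (ν : PseudoAction ρL ρN) (a : L)
    (z : M ⊗[k] N) :
    (tensorAction ν μ).act a (TensorProduct.comm k M N z) =
      Bal.mapRight _ (TensorProduct.comm k M N).toLinearMap (comm_diag ρN ρM)
        ((tensorAction μ ν).act a z) := by
  induction z using TensorProduct.induction_on with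
  | zero => simp
  | add x y h1 h2 => simp only [map_add, h1, h2]
  | tmul m n =>
    rw [TensorProduct.comm_tmul, tensorAction_tmul, tensorAction_tmul, map_add,
      mapRight_comm_comm, add_comm]

theorem evalAct_comm (μ : PseudoAction ρL ρM) (ν : PseudoAction ρL ρN) (a : L) (z : M ⊗[k] N) :
    evalAct (tensorAction ν μ) a (TensorProduct.comm k M N z) =
      TensorProduct.comm k M N (evalAct (tensorAction μ ν) a z) := by
  simp only [evalAct, LinearMap.comp_apply, tensorAction_comm, evalCounit_mapRight]
  rfl

/-- This symmetry is what makes the mixed terms cancel in the cocycle identity. -/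
theorem cross_comm (x : PT2 ρM) (y : PT2 ρN) :
    Bal.mapRight _ (TensorProduct.comm k N M).toLinearMap (comm_diag ρM ρN) (cross ρN ρM y x) =
      flip2 _ (cross ρM ρN x y) := by
  induction x using PT2.induction_on with
  | add x y h1 h2 => simp only [map_add, LinearMap.add_apply, h1, h2]
  | tmul h m =>
    induction y using PT2.induction_on with
    | add x y h1 h2 => simp only [map_add, LinearMap.add_apply, h1, h2]
    | tmul g n => rw [cross_tmul, cross_tmul]; rfl

/-- For `x = (h ⊗ 1) ⊗_H m`, `a` acts on `h(m ⊗ n)`. Hitting `m` gives a nested composition, to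
which Jacobi applies; hitting `n` gives the mixed term. -/
theorem act_evalFst (μ : PseudoAction ρL ρM) (ν : PseudoAction ρL ρN) (a : L) (n : N)
    (x : PT2 ρM) :
    (tensorAction μ ν).act a (evalFst ρM ρN n x) =
      evalThird ρM ρN n (compRight μ a x) + cross ρM ρN x (ν.act a n) := by
  induction x using PT2.induction_on with
  | add x y h1 h2 => simp only [map_add, LinearMap.add_apply, h1, h2]; abel
  | tmul h m =>
    rw [evalThird_compRight, evalFst_tmul, HopfAlgebra.antipode_one, map_one,
      Module.End.one_apply, PseudoAction.act_smul_right, tensorAction_tmul, smul_add]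
    congr 1
    induction ν.act a n using PT2.induction_on with
    | add x y h1 h2 => simp only [map_add, tensorFst_add, smul_add, h1, h2]
    | tmul g n =>
      rw [cross_tmul, tensorFst_tmul, Bal.mapRight_tmul, Bal.smul_tmul]
      simp

theorem coboundary_apply (μ : PseudoAction ρL ρL) (r : L ⊗[k] L) (a : L) :
    coboundary μ r a = evalAct (tensorAction μ μ) a r :=
  d0_tmul _ _ _

theorem coboundary_smul (μ : PseudoAction ρL ρL) (r : L ⊗[k] L) (h : H) (a : L) :
    coboundary μ r (ρL h a) = diag ρL ρL h (coboundary μ r a) := by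
  simp only [coboundary_apply, evalAct_smul_left]

/-- `δ_r` is a 1-cocycle. -/
theorem coboundary_cocycle {μ : PseudoAction ρL ρL} (hμ : IsLieBracket μ) (a b : L)
    (r : L ⊗[k] L) :
    (tensorAction μ μ).act a (coboundary μ r b) -
        flip2 _ ((tensorAction μ μ).act b (coboundary μ r a)) =
      Bal.mapRight _ (coboundary μ r) (coboundary_smul μ r) (μ.act a b) := by
  induction r using TensorProduct.induction_on with
  | zero =>
    have h0 : coboundary μ 0 = 0 := by ext; simp [coboundary_apply]
    have h1 : ∀ x, Bal.mapRight (Bialgebra.comulAlgHom k H) (coboundary μ 0)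
        (coboundary_smul μ 0) x = 0 := by
      intro x
      induction x using PT2.induction_on with
      | tmul h m => rw [Bal.mapRight_tmul, h0]; simp [Bal.tmul]
      | add x y h1 h2 => rw [map_add, h1, h2, add_zero]
    rw [h1, h0]; simp
  | add r s h1 h2 =>
    rw [mapRight_add _ (coboundary_smul μ r) (coboundary_smul μ s)
      (fun m => by simp only [coboundary_apply, map_add]), ← h1, ← h2]
    simp only [coboundary_apply, map_add]
    abel
  | tmul u v =>
    have h1 : Bal.mapRight _ (coboundary μ (u ⊗ₜ v)) (coboundary_smul μ _) (μ.act a b) =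
        Bal.mapRight _ (actFst μ ρL u v) (actFst_smul μ u v) (μ.act a b) +
        Bal.mapRight _ (TensorProduct.comm k L L).toLinearMap (comm_diag ρL ρL)
          (Bal.mapRight _ (actFst μ ρL v u) (actFst_smul μ v u) (μ.act a b)) := by
      induction μ.act a b using PT2.induction_on with
      | tmul g m =>
        simp only [Bal.mapRight_tmul, ← Bal.tmul_add, coboundary_apply, evalAct_tmul]
        rfl
      | add x y h1 h2 => simp only [map_add, h1, h2]; abel
    -- Jacobi is used once for each tensor factor. On expanding the left side, the nested terms
    -- match and the four `cross` terms cancel in pairs.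
    rw [h1, ← evalThird_jacobi hμ, ← evalThird_jacobi hμ]
    simp only [coboundary_apply, evalAct_tmul, map_add, map_sub, tensorAction_comm, act_evalFst,
      flip2_mapRight, cross_comm, flip2_flip2]
    abel

theorem actSndMap_smul (μ : PseudoAction ρL ρL) (p : L ⊗[k] L) (h : H) (c : L) :
    actSndMap μ p (ρL h c) = diag ρL ρL h (actSndMap μ p c) := by
  induction p using TensorProduct.induction_on with
  | zero => simp
  | add x y h1 h2 => simp only [map_add, LinearMap.add_apply, h1, h2]
  | tmul a b =>
    rw [actSndMap_tmul, actSndMap_tmul, ← comm_diag, μ.act_smul_left, evalFst_smul_left]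

/-- The action on the first factor of `r` is the action on the second factor of `r₂₁`, flipped; so
`actSndMap` alone suffices. -/
theorem coboundary_eq (μ : PseudoAction ρL ρL) (r : L ⊗[k] L) (c : L) :
    coboundary μ r c = actSndMap μ r c +
      TensorProduct.comm k L L (actSndMap μ (TensorProduct.comm k L L r) c) := by
  induction r using TensorProduct.induction_on with
  | zero => simp [coboundary_apply]
  | add x y h1 h2 =>
    simp only [coboundary_apply, map_add, LinearMap.add_apply] at h1 h2 ⊢
    rw [h1, h2]; abel
  | tmul a b =>
    rw [coboundary_apply, evalAct_tmul, TensorProduct.comm_tmul, actSndMap_tmul, actSndMap_tmul,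
      add_comm]
    simp

end Cocomm
end Hopf

/-! ### The derivation rule on `L ⊗ L ⊗ L`. -/

section Hopf

variable {k H L : Type*} [CommRing k] [Ring H] [HopfAlgebra k H]
  [AddCommGroup L] [Module k L] {ρL : H →ₐ[k] Module.End k L}

/-- The map `c ⊗ d ↦ actSndMap p c ⊗ d`. -/
def actMid (μ : PseudoAction ρL ρL) (p : L ⊗[k] L) : L ⊗[k] L →ₗ[k] L ⊗[k] (L ⊗[k] L) :=
  (TensorProduct.assoc k L L L).toLinearMap ∘ₗ (actSndMap μ p).rTensor L

theorem actMid_tmul (μ : PseudoAction ρL ρL) (p : L ⊗[k] L) (c d : L) :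
    actMid μ p (c ⊗ₜ d) = TensorProduct.assoc k L L L (actSndMap μ p c ⊗ₜ d) := rfl

/-- The map `((l ⊗ 1) ⊗_H d) ↦ l (z ⊗ d)` for `z ∈ L ⊗ L`. -/
def evalLast (ρL : H →ₐ[k] Module.End k L) (z : L ⊗[k] L) : PT2 ρL →ₗ[k] L ⊗[k] (L ⊗[k] L) :=
  (TensorProduct.assoc k L L L).toLinearMap ∘ₗ (TensorProduct.comm k L (L ⊗[k] L)).toLinearMap ∘ₗ
    evalFst ρL (diag ρL ρL) z

theorem evalLast_add (u v : L ⊗[k] L) (x : PT2 ρL) :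
    evalLast ρL (u + v) x = evalLast ρL u x + evalLast ρL v x := by
  rw [evalLast, LinearMap.comp_apply, LinearMap.comp_apply, evalFst_add, map_add, map_add]
  rfl

theorem evalLast_neg (u : L ⊗[k] L) (x : PT2 ρL) : evalLast ρL (-u) x = -evalLast ρL u x := by
  have h1 := evalLast_add (-u) u x
  rw [neg_add_cancel, evalLast, LinearMap.comp_apply, LinearMap.comp_apply, evalFst_zero, map_zero,
    map_zero] at h1
  exact eq_neg_of_add_eq_zero_left h1.symm

variable [Coalgebra.IsCocomm k H]

theorem comm_evalFst_flip2 (a : L) (h : H) (e : L) :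
    TensorProduct.comm k L L (evalFst ρL ρL a (flip2 _ (Bal.tmul _ ρL (h ⊗ₜ 1) e))) =
      ρL (HopfAlgebra.antipode k h) a ⊗ₜ e := by
  simp [flip2_tmul, evalFst_tmul]

theorem antiAct_fourier (y : L) (x : PT2 ρL) :
    antiAct ρL y (fourier ρL x) = TensorProduct.comm k L L (evalFst ρL ρL y (flip2 _ x)) := by
  induction x using PT2.induction_on with
  | tmul h e => rw [comm_evalFst_flip2, fourier_tmul_one]; simp [antiAct]
  | add x y h1 h2 => simp only [map_add, h1, h2]

/-- Flipping `(h ⊗ 1) ⊗_H e` puts `h` where `evalFst` applies the antipode. Skew-commutativity thus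
identifies the twist `S(h) y ⊗ e` in `[[r,r]]` with a value of `actSndMap`. -/
theorem antiAct_fbr {μ : PseudoAction ρL ρL} (hμ : IsLieBracket μ) (y a c : L) :
    antiAct ρL y (fbr μ a c) = - actSndMap μ (y ⊗ₜ a) c := by
  rw [fbr, antiAct_fourier, actSndMap_tmul, hμ.skew a c]
  simp

theorem actMid_smul (μ : PseudoAction ρL ρL) (p : L ⊗[k] L) (h : H) (q : L ⊗[k] L) :
    actMid μ p (diag ρL ρL h q) = diag ρL (diag ρL ρL) h (actMid μ p q) := by
  rw [actMid, LinearMap.comp_apply, diag_map _ (actSndMap_smul μ p)]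
  exact diag_assoc _ _

theorem evalLast_tmul (u e : L) (x : PT2 ρL) :
    evalLast ρL (u ⊗ₜ e) x = TensorProduct.comm k (L ⊗[k] L) L (evalFst (diag ρL ρL) ρL u
      (Bal.mapRight _ (TensorProduct.comm k L L).toLinearMap (comm_diag ρL ρL)
        (tensorFst ρL ρL x e))) := by
  induction x using PT2.induction_on with
  | add x y h1 h2 => simp only [map_add, tensorFst_add, h1, h2]
  | tmul l d =>
    rw [tensorFst_tmul, Bal.mapRight_tmul, evalFst_tmul, evalLast, LinearMap.comp_apply,
      LinearMap.comp_apply, evalFst_tmul, LinearEquiv.coe_coe, LinearEquiv.coe_coe, comm_diag,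
      diag_assoc, comm_diag]
    simp

theorem actMid_comm_evalFst (μ : PseudoAction ρL ρL) (p : L ⊗[k] L) (c : L) (x : PT2 ρL) :
    actMid μ p (TensorProduct.comm k L L (evalFst ρL ρL c x)) =
      evalLast ρL (actSndMap μ p c) x := by
  rw [evalLast, LinearMap.comp_apply, LinearMap.comp_apply, evalFst_map _ (actSndMap_smul μ p)]
  generalize evalFst ρL ρL c x = z
  induction z using TensorProduct.induction_on with
  | zero => simp
  | add x y h1 h2 => simp only [map_add, h1, h2]
  | tmul u v => rfl

/-- For `y = (h ⊗ 1) ⊗_H e` the argument is `S(h) a ⊗ e ⊗ d`, and the summands are the actions of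
`x` on the three factors. In the first, `x * S(h) a` moves `S(S(h)) = h` onto `e ⊗ d`, which
recovers `evalFst`. -/
theorem evalAct_assoc_comm_evalFst (μ : PseudoAction ρL ρL) (x a d : L) (y : PT2 ρL) :
    evalAct (tensorAction μ (tensorAction μ μ)) x (TensorProduct.assoc k L L L
      (TensorProduct.comm k L L (evalFst ρL ρL a (flip2 _ y)) ⊗ₜ d)) =
    evalFst ρL (diag ρL ρL) (evalFst ρL ρL d y) (μ.act x a) +
      TensorProduct.comm k (L ⊗[k] L) L
        (evalFst (diag ρL ρL) ρL a (evalThird ρL ρL d (compRight μ x y))) +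
      evalLast ρL (TensorProduct.comm k L L (evalFst ρL ρL a (flip2 _ y))) (μ.act x d) := by
  induction y using PT2.induction_on with
  | add y z h1 h2 =>
    simp only [map_add, TensorProduct.add_tmul, evalFst_add, evalLast_add, h1, h2]
    abel
  | tmul h e =>
    rw [comm_evalFst_flip2, TensorProduct.assoc_tmul, evalAct_tmul, μ.act_smul_right,
      evalFst_smul_right, antipode_antipode, tensorAction_tmul, map_add, map_add,
      evalThird_compRight, evalFst_smul_right, evalLast_tmul, evalFst_tmul]
    simp [add_assoc]

/-- For `x` replaced by some `y * c`, this turns the evaluated form of `a ⊗ [[y,c],b] ⊗ d` into `-a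
⊗ [b,[y,c]] ⊗ d`, the shape in which it occurs in Jacobi. -/
theorem actMid_evalFst {μ : PseudoAction ρL ρL} (hμ : IsLieBracket μ) (a b d : L) (x : PT2 ρL) :
    actMid μ (a ⊗ₜ b) (evalFst ρL ρL d x) = - TensorProduct.comm k (L ⊗[k] L) L
      (evalFst (diag ρL ρL) ρL a (flip2 _ (evalThird ρL ρL d (compRight μ b x)))) := by
  induction x using PT2.induction_on with
  | add x y h1 h2 => simp only [map_add, h1, h2]; abel
  | tmul l c =>
    rw [evalFst_tmul, HopfAlgebra.antipode_one, map_one, Module.End.one_apply, actMid_smul,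
      actMid_tmul, actSndMap_tmul, hμ.skew b c, evalThird_compRight, flip2_smul,
      evalFst_smul_left, comm_diag, ← map_neg (diag ρL (diag ρL ρL) l)]
    refine congrArg (diag ρL (diag ρL ρL) l) ?_
    induction μ.act b c using PT2.induction_on with
    | add x y h1 h2 =>
      simp only [map_add, neg_add, tensorFst_add, TensorProduct.add_tmul, h1, h2]
    | tmul h e =>
      rw [map_neg, map_neg, comm_evalFst_flip2, tensorFst_tmul, flip2_tmul]
      simp [evalFst_tmul, TensorProduct.neg_tmul]

/-- The derivation rule for `actMid p q`. -/
theorem evalAct_actMid {μ : PseudoAction ρL ρL} (hμ : IsLieBracket μ) (x : L) (p q : L ⊗[k] L) :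
    evalAct (tensorAction μ (tensorAction μ μ)) x (actMid μ p q) =
      actMid μ p (evalAct (tensorAction μ μ) x q) -
        ((TensorProduct.comm k L L).toLinearMap ∘ₗ
          actSndMap μ (TensorProduct.comm k L L q)).lTensor L
            (evalAct (tensorAction μ μ) x p) := by
  induction p using TensorProduct.induction_on with
  | zero => simp [actMid]
  | add p p' h1 h2 =>
    have h3 : actMid μ (p + p') = actMid μ p + actMid μ p' := by
      simp only [actMid, map_add, LinearMap.rTensor_add, LinearMap.comp_add]
    simp only [h3, LinearMap.add_apply, map_add, h1, h2]
    abel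
  | tmul a b =>
    induction q using TensorProduct.induction_on with
    | zero => simp
    | add q q' h1 h2 =>
      simp only [map_add, LinearMap.comp_add, LinearMap.lTensor_add, LinearMap.add_apply, h1, h2]
      abel
    | tmul c d =>
      have h1 : (TensorProduct.comm k L L).toLinearMap ∘ₗ
          actSndMap μ (TensorProduct.comm k L L (c ⊗ₜ d)) = actFst μ ρL c d := by
        ext e
        simp [actSndMap_tmul, actFst]
      have h2 : ∀ z : L ⊗[k] L, (actFst μ ρL c d).lTensor L (TensorProduct.comm k L L z) =
          TensorProduct.comm k (L ⊗[k] L) L ((actFst μ ρL c d).rTensor L z) := by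
        intro z
        induction z using TensorProduct.induction_on with
        | zero => simp
        | add x y h1 h2 => simp only [map_add, h1, h2]
        | tmul u v => rfl
      -- Rewriting `[c, b]` as `-[b, c]` gives the form `-S(h) a ⊗ e`, with no diagonal `H`-action
      -- in front, on which the action of `x` can be computed factor by factor.
      have h3 : actSndMap μ (a ⊗ₜ b) c =
          - TensorProduct.comm k L L (evalFst ρL ρL a (flip2 _ (μ.act b c))) := by
        rw [actSndMap_tmul, hμ.skew b c, map_neg, map_neg]
      rw [h1, evalAct_tmul, evalAct_tmul, map_add, map_add, h2, ← evalFst_mapRight _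
        (actFst_smul μ c d), ← evalThird_jacobi hμ, ← evalFst_map _ (actFst_smul μ c d),
        actMid_comm_evalFst, actMid_evalFst hμ, actMid_tmul, h3, TensorProduct.neg_tmul, map_neg,
        map_neg, evalAct_assoc_comm_evalFst, evalLast_neg, map_sub, map_sub]
      simp only [actFst, LinearMap.comp_apply, LinearMap.flip_apply]
      abel

end Hopf

/-! ### Permutations of the factors, and the co-Jacobi defect. -/

section Hopf

variable {k H L : Type*} [CommRing k] [Ring H] [HopfAlgebra k H]
  [AddCommGroup L] [Module k L] {ρL : H →ₐ[k] Module.End k L}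

theorem leftComm_assoc (z : L ⊗[k] L) (c : L) :
    TensorProduct.leftComm k L L L (TensorProduct.assoc k L L L (z ⊗ₜ c)) =
      TensorProduct.assoc k L L L (TensorProduct.comm k L L z ⊗ₜ c) := by
  induction z using TensorProduct.induction_on with
  | zero => simp
  | add x y h1 h2 => simp only [TensorProduct.add_tmul, map_add, h1, h2]
  | tmul a b => simp

theorem leftComm_leftComm (z : L ⊗[k] (L ⊗[k] L)) :
    TensorProduct.leftComm k L L L (TensorProduct.leftComm k L L L z) = z :=
  (TensorProduct.leftComm k L L L).symm_apply_apply z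

theorem lTensor_comm_comm (z : L ⊗[k] (L ⊗[k] L)) :
    (TensorProduct.comm k L L).toLinearMap.lTensor L
      ((TensorProduct.comm k L L).toLinearMap.lTensor L z) = z := by
  rw [← LinearMap.comp_apply, ← LinearMap.lTensor_comp]
  have : (TensorProduct.comm k L L).toLinearMap ∘ₗ (TensorProduct.comm k L L).toLinearMap =
      LinearMap.id := by ext; simp
  rw [this, LinearMap.lTensor_id, LinearMap.id_apply]

theorem lTensor_actSndMap_eq (μ : PseudoAction ρL ρL) (p q : L ⊗[k] L) :
    (actSndMap μ p).lTensor L q = TensorProduct.leftComm k L L L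
      ((TensorProduct.comm k L L).toLinearMap.lTensor L
        (actMid μ p (TensorProduct.comm k L L q))) := by
  induction q using TensorProduct.induction_on with
  | zero => simp
  | add x y h1 h2 => simp only [map_add, h1, h2]
  | tmul a b =>
    rw [LinearMap.lTensor_tmul, TensorProduct.comm_tmul, actMid_tmul]
    generalize actSndMap μ p b = z
    induction z using TensorProduct.induction_on with
    | zero => simp
    | add x y h1 h2 => simp only [TensorProduct.tmul_add, TensorProduct.add_tmul, map_add, h1, h2]
    | tmul u v => simp

variable [Coalgebra.IsCocomm k H]

/-- Through associativity this reduces to the two-factor flip, where cocommutativity enters. -/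
theorem leftComm_diag (h : H) (z : L ⊗[k] (L ⊗[k] L)) :
    TensorProduct.leftComm k L L L (diag ρL (diag ρL ρL) h z) =
      diag ρL (diag ρL ρL) h (TensorProduct.leftComm k L L L z) := by
  have h1 : ∀ w : (L ⊗[k] L) ⊗[k] L,
      TensorProduct.leftComm k L L L (TensorProduct.assoc k L L L w) =
      TensorProduct.assoc k L L L ((TensorProduct.comm k L L).toLinearMap.rTensor L w) := by
    intro w
    induction w using TensorProduct.induction_on with
    | zero => simp
    | add x y h1 h2 => simp only [map_add, h1, h2]
    | tmul z c => exact leftComm_assoc z c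
  obtain ⟨w, rfl⟩ := (TensorProduct.assoc k L L L).surjective z
  rw [← diag_assoc, h1, h1, diag_map _ (comm_diag ρL ρL), diag_assoc]

theorem evalAct_lTensor_comm (μ : PseudoAction ρL ρL) (x : L) (z : L ⊗[k] (L ⊗[k] L)) :
    evalAct (tensorAction μ (tensorAction μ μ)) x
        ((TensorProduct.comm k L L).toLinearMap.lTensor L z) =
      (TensorProduct.comm k L L).toLinearMap.lTensor L
        (evalAct (tensorAction μ (tensorAction μ μ)) x z) := by
  induction z using TensorProduct.induction_on with
  | zero => simp
  | add x y h1 h2 => simp only [map_add, h1, h2]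
  | tmul a z =>
    rw [LinearMap.lTensor_tmul, evalAct_tmul, evalAct_tmul, LinearEquiv.coe_coe,
      tensorAction_comm, evalFst_mapRight, map_add, ← evalFst_map _ (comm_diag ρL ρL)]
    congr 1
    generalize evalFst (diag ρL ρL) ρL a ((tensorAction μ μ).act x z) = w
    induction w using TensorProduct.induction_on with
    | zero => simp
    | add x y h1 h2 => simp only [map_add, h1, h2]
    | tmul a z => rfl

theorem leftComm_evalLast (u v : L) (x : PT2 ρL) :
    TensorProduct.leftComm k L L L (evalLast ρL (u ⊗ₜ v) x) = evalLast ρL (v ⊗ₜ u) x := by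
  induction x using PT2.induction_on with
  | add x y h1 h2 => simp only [map_add, h1, h2]
  | tmul l d =>
    simp only [evalLast, LinearMap.comp_apply, evalFst_tmul, LinearEquiv.coe_coe, comm_diag,
      diag_assoc, leftComm_diag]
    simp

theorem leftComm_evalFst (b c : L) (x : PT2 ρL) :
    TensorProduct.leftComm k L L L (evalFst ρL (diag ρL ρL) (b ⊗ₜ c) x) =
      TensorProduct.comm k (L ⊗[k] L) L
        (evalFst (diag ρL ρL) ρL b (tensorFst ρL ρL x c)) := by
  induction x using PT2.induction_on with
  | add x y h1 h2 => simp only [map_add, tensorFst_add, h1, h2]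
  | tmul l d =>
    simp only [tensorFst_tmul, evalFst_tmul, comm_diag, leftComm_diag]
    simp

theorem evalAct_leftComm (μ : PseudoAction ρL ρL) (x : L) (z : L ⊗[k] (L ⊗[k] L)) :
    evalAct (tensorAction μ (tensorAction μ μ)) x (TensorProduct.leftComm k L L L z) =
      TensorProduct.leftComm k L L L (evalAct (tensorAction μ (tensorAction μ μ)) x z) := by
  induction z using TensorProduct.induction_on with
  | zero => simp
  | add x y h1 h2 => simp only [map_add, h1, h2]
  | tmul a z =>
    induction z using TensorProduct.induction_on with
    | zero => simp
    | add x y h1 h2 => simp only [TensorProduct.tmul_add, map_add, h1, h2]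
    | tmul b c =>
      -- In this form, exchanging `a` and `b` swaps the first two summands up to `τ₁₂` and permutes
      -- the third into itself.
      have h1 : ∀ a b c : L, evalAct (tensorAction μ (tensorAction μ μ)) x (a ⊗ₜ (b ⊗ₜ c)) =
          evalFst ρL (diag ρL ρL) (b ⊗ₜ c) (μ.act x a) +
          TensorProduct.leftComm k L L L
            (evalFst ρL (diag ρL ρL) (a ⊗ₜ c) (μ.act x b)) +
          evalLast ρL (a ⊗ₜ b) (μ.act x c) := by
        intro a b c
        rw [evalAct_tmul, tensorAction_tmul, map_add, map_add, evalLast_tmul, leftComm_evalFst,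
          add_assoc]
      rw [TensorProduct.leftComm_tmul, h1, h1, map_add, map_add, leftComm_evalLast,
        leftComm_leftComm]
      abel

/-- This is the derivation rule `evalAct_actMid` conjugated by a permutation of the three factors,
which makes it symmetric in form: `p` and `q` exchange roles under `τ₁₂`. -/
theorem evalAct_lTensor_actSndMap {μ : PseudoAction ρL ρL} (hμ : IsLieBracket μ) (x : L)
    (p q : L ⊗[k] L) :
    evalAct (tensorAction μ (tensorAction μ μ)) x ((actSndMap μ p).lTensor L q) =
      (actSndMap μ p).lTensor L (evalAct (tensorAction μ μ) x q) -
        TensorProduct.leftComm k L L L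
          ((actSndMap μ q).lTensor L (evalAct (tensorAction μ μ) x p)) := by
  have h1 : TensorProduct.comm k L L (TensorProduct.comm k L L q) = q := by simp
  rw [lTensor_actSndMap_eq, evalAct_leftComm, evalAct_lTensor_comm, evalAct_actMid hμ,
    evalAct_comm, h1, map_sub, map_sub, ← lTensor_actSndMap_eq, LinearMap.lTensor_comp,
    LinearMap.comp_apply, lTensor_comm_comm]

/-- The three summands on the right are the third, second and first terms of `[[r,r]]`; each changes
sign by `antiAct_fbr`. -/
theorem yangBaxter_eq {μ : PseudoAction ρL ρL} (hμ : IsLieBracket μ) {ι : Type*} [Fintype ι]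
    (a b : ι → L) (r : L ⊗[k] L) (hr : r = ∑ i, a i ⊗ₜ[k] b i) :
    yangBaxter μ a b =
      (actSndMap μ r).lTensor L r +
        (TensorProduct.comm k L L).toLinearMap.lTensor L
          ((actSndMap μ (TensorProduct.comm k L L r)).lTensor L r) -
        TensorProduct.leftComm k L L L (actMid μ (TensorProduct.comm k L L r) r) := by
  have h1 : TensorProduct.comm k L L r = ∑ i, b i ⊗ₜ[k] a i := by simp [hr]
  rw [h1]
  conv_rhs => rw [hr]
  simp only [map_sum, LinearMap.lTensor_tmul, actMid_tmul, LinearMap.sum_apply,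
    TensorProduct.sum_tmul, TensorProduct.tmul_sum, leftComm_assoc, LinearEquiv.coe_coe]
  rw [← Finset.sum_add_distrib, ← Finset.sum_sub_distrib, yangBaxter]
  refine Finset.sum_congr rfl fun i _ => ?_
  rw [← Finset.sum_add_distrib, ← Finset.sum_sub_distrib]
  refine Finset.sum_congr rfl fun j _ => ?_
  simp only [antiAct_fbr hμ, map_neg, TensorProduct.neg_tmul, TensorProduct.tmul_neg]
  abel

/-- If `δ_r(x)` is skew-symmetric, the co-Jacobi identity for `δ_r` fails at `x` exactly by
`μ₃(x · [[r, r]])`. -/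
theorem coJacobi_defect {μ : PseudoAction ρL ρL} (hμ : IsLieBracket μ) {ι : Type*} [Fintype ι]
    (a b : ι → L) (r : L ⊗[k] L) (hr : r = ∑ i, a i ⊗ₜ[k] b i) (x : L)
    (hx : TensorProduct.comm k L L (coboundary μ r x) = - coboundary μ r x) :
    (coboundary μ r).lTensor L (coboundary μ r x) -
      TensorProduct.leftComm k L L L ((coboundary μ r).lTensor L (coboundary μ r x)) -
        TensorProduct.assoc k L L L ((coboundary μ r).rTensor L (coboundary μ r x)) =
      evalAct (tensorAction μ (tensorAction μ μ)) x (yangBaxter μ a b) := by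
  have hD : evalAct (tensorAction μ μ) x r = coboundary μ r x := (coboundary_apply μ r x).symm
  have hD' : evalAct (tensorAction μ μ) x (TensorProduct.comm k L L r) = - coboundary μ r x := by
    rw [evalAct_comm, hD, hx]
  have h1 : coboundary μ r = actSndMap μ r +
      (TensorProduct.comm k L L).toLinearMap ∘ₗ actSndMap μ (TensorProduct.comm k L L r) := by
    ext c; exact coboundary_eq μ r c
  have h2 : ∀ z, TensorProduct.assoc k L L L ((coboundary μ r).rTensor L z) = actMid μ r z +
      TensorProduct.leftComm k L L L (actMid μ (TensorProduct.comm k L L r) z) := by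
    intro z
    rw [h1]
    induction z using TensorProduct.induction_on with
    | zero => simp
    | add x y h1 h2 => simp only [map_add, h1, h2]; abel
    | tmul a b =>
      rw [actMid_tmul, actMid_tmul, leftComm_assoc]
      simp
  have h3 : ∀ z, (coboundary μ r).lTensor L z = (actSndMap μ r).lTensor L z +
      (TensorProduct.comm k L L).toLinearMap.lTensor L
        ((actSndMap μ (TensorProduct.comm k L L r)).lTensor L z) := by
    intro z
    rw [h1, LinearMap.lTensor_add, LinearMap.add_apply, LinearMap.lTensor_comp,
      LinearMap.comp_apply]
  -- Skewness of `δ_r(x)` enters a second time here: it trades acting on the first factor for acting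
  -- on the second, so that this half of `(δ_r ⊗ 1)δ_r(x)` matches a term produced by the derivation
  -- rule.
  have h4 : actMid μ r (coboundary μ r x) = - (TensorProduct.comm k L L).toLinearMap.lTensor L
      (TensorProduct.leftComm k L L L ((actSndMap μ r).lTensor L (coboundary μ r x))) := by
    rw [lTensor_actSndMap_eq, hx, leftComm_leftComm, lTensor_comm_comm, map_neg, neg_neg]
  rw [yangBaxter_eq hμ a b r hr, map_sub, map_add, evalAct_lTensor_comm, evalAct_leftComm,
    evalAct_lTensor_actSndMap hμ, evalAct_lTensor_actSndMap hμ, evalAct_actMid hμ, hD, hD', h2, h3,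
    h4, LinearMap.lTensor_comp, LinearMap.comp_apply]
  simp only [map_add, map_sub, map_neg]
  abel

end Hopf

end LiePseudo

end

/-! ### The formula for `δ_r` and the criterion. -/

theorem mainTheorem2 {k H L : Type*} [Field k] [IsAlgClosed k] [CharZero k]
    [Ring H] [HopfAlgebra k H] [Coalgebra.IsCocomm k H]
    [AddCommGroup L] [Module k L] [Module H L] [IsScalarTower k H L]
    (μ : PseudoAction (regAct k H L) (regAct k H L)) (hμ : IsLieBracket μ)
    {ι : Type*} [Fintype ι] (a b : ι → L) (r : L ⊗[k] L) (hr : r = ∑ i, a i ⊗ₜ[k] b i) :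
    (∀ x : L, coboundary μ r x =
      ∑ i, actMap (diag (regAct k H L) (regAct k H L))
        (TensorProduct.assoc k H L L (fbr μ x (a i) ⊗ₜ[k] b i) +
          TensorProduct.leftComm k L H L (a i ⊗ₜ[k] fbr μ x (b i)))) ∧
    (IsLiePseudoBialgebra μ (coboundary μ r) ↔
      (∀ x : L, coboundary μ (r + TensorProduct.comm k L L r) x = 0) ∧
      (∀ x : L,
        actMap (diag (regAct k H L) (diag (regAct k H L) (regAct k H L)))
          (fbr (tensorAction μ (tensorAction μ μ)) x (yangBaxter μ a b)) = 0)) := by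
  -- Since `δ_{r₂₁} = τ ∘ δ_r`, invariance of the symmetric part and skewness of `δ_r` coincide
  -- pointwise in `x`.
  have hskew : ∀ x : L, coboundary μ (r + TensorProduct.comm k L L r) x = 0 ↔
      TensorProduct.comm k L L (coboundary μ r x) = - coboundary μ r x := by
    intro x
    rw [coboundary_apply, coboundary_apply, map_add, evalAct_comm, eq_neg_iff_add_eq_zero,
      add_comm]
  refine ⟨fun x => ?_, fun h => ⟨fun x => (hskew x).2 (h.coalgebra.skew x), fun x => ?_⟩,
    fun h => ?_⟩
  · rw [coboundary_apply, hr, map_sum]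
    refine Finset.sum_congr rfl fun i _ => ?_
    rw [← evalCounit_unFourier]
    rfl
  -- `μ₃(x · z)` is the evaluated action `evalAct` on `z`, so condition (2) says that the co-Jacobi
  -- defect vanishes.
  · rw [actMap_fbr, ← coJacobi_defect hμ a b r hr x (h.coalgebra.skew x), sub_eq_zero]
    exact h.coalgebra.coJacobi x
  · have hs := fun x => (hskew x).1 (h.1 x)
    refine ⟨hμ, ⟨coboundary_smul μ r, hs, fun x => ?_⟩,
      fun x y => coboundary_cocycle hμ x y r⟩
    rw [← sub_eq_zero, coJacobi_defect hμ a b r hr x (hs x), ← actMap_fbr]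
    exact h.2 x
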